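/- Let $k$ be a finite field and let $Y$ be a geometrically irreducible smooth projective curve over $k$ with function field $K$ and genus $g_Y=\dim_k H^1(Y,\mathcal{O}_Y)$. For each closed point $\mathfrak{q}\in Y$ let $\hat{\mathcal{O}}_{Y,\mathfrak{q}}$ be the completion of the local ring $\mathcal{O}_{Y,\mathfrak{q}}$ and let $K_{\mathfrak{q}}$ be its field of fractions, that is, the completion of $K$ at $\mathfrak{q}$. Let $\mathbb{A}_K$ be the ring of adeles of $K$, that is, the restricted product of the fields $K_{\mathfrak{q}}$ relative to the subrings $\hat{\mathcal{O}}_{Y,\mathfrak{q}}$, with its usual topology, and embed $K$ diagonally into $\mathbb{A}_K$. Let $dx_{\mathfrak{q}}$ be the (unique) Haar measure on the additive group $K_{\mathfrak{q}}$ for which $\hat{\mathcal{O}}_{Y,\mathfrak{q}}$ has volume $1$, and let $\mu=\prod_{\mathfrak{q}}dx_{\mathfrak{q}}$ be the product measure on $\mathbb{A}_K$, that is, the unique Borel measure with $\mu\bigl(\prod_{\mathfrak{q}}B_{\mathfrak{q}}\bigr)=\prod_{\mathfrak{q}\in S}dx_{\mathfrak{q}}(B_{\mathfrak{q}})$ whenever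 $S$ is a finite set of closed points, the sets $B_{\mathfrak{q}}\subseteq K_{\mathfrak{q}}$ are Borel, and $B_{\mathfrak{q}}=\hat{\mathcal{O}}_{Y,\mathfrak{q}}$ for all $\mathfrak{q}\notin S$. Then the quotient $\mathbb{A}_K/K$ is compact, and its volume with respect to $\mu$ (the $\mu$-measure of a fundamental domain for $K$ in $\mathbb{A}_K$) is equal to $|k|^{g_Y-1}$. -/

import Mathlib

open AlgebraicGeometry CategoryTheory MeasureTheory
open scoped RestrictedProduct

universe u

/-- A geometrically irreducible smooth projective curve over a field `k`: an integral scheme,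
proper, smooth of relative dimension one and geometrically irreducible over `k`.
(A curve over a field is proper if and only if it is projective.) -/
structure SmoothProjCurve (k : Type u) [Field k] where
  /-- the underlying scheme -/
  X : Scheme.{u}
  /-- the structure morphism to `Spec k` -/
  hom : X ⟶ Spec (.of k)
  isIntegral : IsIntegral X
  isProper : IsProper hom
  smooth : SmoothOfRelativeDimension 1 hom
  geometricallyIrreducible : GeometricallyIrreducible hom

attribute [instance] SmoothProjCurve.isIntegral SmoothProjCurve.isProper SmoothProjCurve.smooth
  SmoothProjCurve.geometricallyIrreducible

/-- A standard smooth algebra of relative dimension one over a field, if it is a domain, has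
discrete valuation rings as its local rings at maximal ideals. -/
theorem isDiscreteValuationRing_localization_of_standardSmooth
    {A B : Type*} [CommRing A] [CommRing B] [IsDomain B]
    (hA : IsField A) (φ : A →+* B) (hφ : φ.IsStandardSmoothOfRelativeDimension 1)
    (q : Ideal B) [q.IsMaximal] :
    IsDiscreteValuationRing (Localization.AtPrime q) := by
  let : Field A := hA.toField
  let L := Localization.AtPrime q
  obtain ⟨g, -, hg⟩ := hφ.exists_etale_mvPolynomial
  algebraize [g]
  let P := MvPolynomial (Fin 1) A
  let e : P ≃+* Polynomial A := (MvPolynomial.uniqueAlgEquiv A (Fin 1)).toRingEquiv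
  have hPIR : IsPrincipalIdealRing P := .of_surjective e.symm.toRingHom e.symm.surjective
  let p := q.under P
  have hpmax : p.IsMaximal := by
    let : Field (B ⧸ q) := Ideal.Quotient.field q
    have : Module.Finite P (B ⧸ q) := finite_of_finite_type_of_isJacobsonRing P (B ⧸ q)
    have := Ideal.isMaximal_comap_of_isIntegral_of_isMaximal (R := P) (⊥ : Ideal (B ⧸ q))
    have h2 : p = (⊥ : Ideal (B ⧸ q)).comap (algebraMap P (B ⧸ q)) := by
      ext x
      change algebraMap P B x ∈ q ↔ algebraMap P (B ⧸ q) x = 0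
      rw [IsScalarTower.algebraMap_apply P B (B ⧸ q),
        Ideal.Quotient.algebraMap_eq, Ideal.Quotient.eq_zero_iff_mem]
    rwa [h2]
  have hp : p ≠ ⊥ := by
    intro h
    have hF : IsField P := Ring.isField_iff_maximal_bot.mpr (h ▸ hpmax)
    exact Polynomial.not_isField A (e.symm.toMulEquiv.isField hF)
  have hfl : Module.Flat P B := inferInstance
  have hinj : Function.Injective (algebraMap P B) := FaithfulSMul.algebraMap_injective P B
  have hN : IsNoetherianRing B := Algebra.FiniteType.isNoetherianRing P B
  have hN' : IsNoetherianRing L := IsLocalization.isNoetherianRing q.primeCompl _ hN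
  let := Localization.AtPrime.algebraOfLiesOver p q
  have hm := ((Algebra.isUnramifiedAt_iff_map_eq P p q).mp inferInstance).2
  have hm' : (p.map (algebraMap P B)).map (algebraMap B L) = IsLocalRing.maximalIdeal L := by
    rw [Ideal.map_map, ← IsScalarTower.algebraMap_eq]; exact hm
  have hpr : (IsLocalRing.maximalIdeal L).IsPrincipal := by
    rw [← hm']; infer_instance
  have hnf : ¬ IsField L := by
    rw [IsLocalRing.isField_iff_maximalIdeal_eq, ← hm', Ideal.map_map]
    intro h
    rw [Ideal.map_eq_bot_iff_of_injective] at h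
    · exact hp h
    · exact (IsLocalization.injective L q.primeCompl_le_nonZeroDivisors).comp hinj
  exact ((IsDiscreteValuationRing.TFAE L hnf).out 4 0).mp hpr

noncomputable section

namespace SmoothProjCurve

variable {k : Type u} [Field k] (Y : SmoothProjCurve k)

/-- The function field `K = K(Y)`. -/
abbrev functionField : Type u := Y.X.functionField

/-- The closed points of `Y`. -/
structure ClosedPoint where
  /-- the underlying point -/
  point : Y.X
  isClosed : IsClosed {point}

variable {Y}

/-- The local ring of `Y` at a closed point. -/
abbrev localRing (q : Y.ClosedPoint) : Type u := Y.X.presheaf.stalk q.point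

instance (q : Y.ClosedPoint) : IsDiscreteValuationRing (localRing q) := by
  obtain ⟨y, hy⟩ := q
  obtain ⟨U, hU, V, hV, hyV, e, h⟩ :=
    SmoothOfRelativeDimension.exists_isStandardSmoothOfRelativeDimension (n := 1) (f := Y.hom) y
  have : Nonempty V := ⟨⟨y, hyV⟩⟩
  have hq := hV.primeIdealOf_isMaximal_of_isClosed ⟨y, hyV⟩ hy
  have hL := hV.isLocalization_stalk ⟨y, hyV⟩
  have hUtop : U = ⊤ := by
    ext x
    have : x = Y.hom y := Subsingleton.elim (α := PrimeSpectrum k) _ _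
    simp only [this, SetLike.mem_coe, TopologicalSpace.Opens.coe_top, Set.mem_univ, iff_true]
    exact e hyV
  have hA : IsField Γ(Spec (.of k), U) := by
    subst hUtop
    exact (Scheme.ΓSpecIso (.of k)).commRingCatIsoToRingEquiv.toMulEquiv.isField
      (Field.toIsField k)
  have := isDiscreteValuationRing_localization_of_standardSmooth hA _ h
    (hV.primeIdealOf ⟨y, hyV⟩).asIdeal
  let := TopCat.Presheaf.algebra_section_stalk Y.X.presheaf (⟨y, hyV⟩ : V)
  exact IsDiscreteValuationRing.RingEquivClass.isDiscreteValuationRing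
    (IsLocalization.algEquiv (hV.primeIdealOf ⟨y, hyV⟩).asIdeal.primeCompl
     (Localization.AtPrime (hV.primeIdealOf ⟨y, hyV⟩).asIdeal) (Y.X.presheaf.stalk y))

/-- The place of `K` given by a closed point `q`: the maximal ideal of the local ring at `q`. -/
def place (q : Y.ClosedPoint) : IsDedekindDomain.HeightOneSpectrum (localRing q) :=
  IsDiscreteValuationRing.maximalIdeal (localRing q)

/-- `K_q`, the completion of the function field `K` at the closed point `q`. -/
abbrev completion (q : Y.ClosedPoint) : Type u := (place q).adicCompletion Y.functionField

/-- The ring of integers of `K_q`, that is, the completion of the local ring of `Y` at `q`. -/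
abbrev completionIntegers (q : Y.ClosedPoint) : ValuationSubring (completion q) :=
  (place q).adicCompletionIntegers Y.functionField

/-- `K_q` carries its Borel σ-algebra. -/
instance (q : Y.ClosedPoint) : MeasurableSpace (completion q) := borel _

instance (q : Y.ClosedPoint) : BorelSpace (completion q) := ⟨rfl⟩

variable (Y)

/-- The ring of adeles of `K`: the restricted product over all closed points `q` of the fields
`K_q` relative to their rings of integers, with the restricted product topology. -/
def Adele : Type u := Πʳ q : Y.ClosedPoint, [completion q, completionIntegers q]

instance : CommRing Y.Adele :=
  inferInstanceAs <| CommRing <| Πʳ q : Y.ClosedPoint, [completion q, completionIntegers q]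

instance : TopologicalSpace Y.Adele :=
  inferInstanceAs <| TopologicalSpace <|
    Πʳ q : Y.ClosedPoint, [completion q, completionIntegers q]

instance : DFunLike Y.Adele Y.ClosedPoint completion where
  coe a := a.1
  coe_injective _ _ := Subtype.ext

instance : IsTopologicalRing Y.Adele :=
  haveI : Fact (∀ q : Y.ClosedPoint, IsOpen (completionIntegers q : Set (completion q))) :=
    ⟨fun _ ↦ Valued.isOpen_valuationSubring _⟩
  RestrictedProduct.isTopologicalRing (fun q : Y.ClosedPoint ↦ completion q)

/-- The adeles carry their Borel σ-algebra. -/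
instance : MeasurableSpace Y.Adele := borel _

instance : BorelSpace Y.Adele := ⟨rfl⟩

variable {Y} in
/-- A point that specializes to a closed point `q` is `q` or the generic point. -/
theorem eq_or_eq_genericPoint_of_specializes (q : Y.ClosedPoint) {y : Y.X} (h : y ⤳ q.point) :
    y = q.point ∨ y = genericPoint Y.X := by
  have hr := Scheme.range_fromSpecStalk (x := q.point)
  obtain ⟨z, hz⟩ : y ∈ Set.range (Y.X.fromSpecStalk q.point) := hr ▸ h
  obtain ⟨w, hw⟩ : genericPoint Y.X ∈ Set.range (Y.X.fromSpecStalk q.point) :=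
    hr ▸ genericPoint_specializes q.point
  by_cases hb : z.asIdeal = ⊥
  · right
    have hzw : z ⤳ w := by
      refine (PrimeSpectrum.le_iff_specializes z w).mp ?_
      have h0 : z.asIdeal ≤ w.asIdeal := hb ▸ bot_le
      exact h0
    have := hzw.map (Y.X.fromSpecStalk q.point).continuous
    rw [hz, hw] at this
    exact (this.antisymm (genericPoint_specializes y)).eq
  · left
    have hmax := IsLocalRing.eq_maximalIdeal (z.isPrime.isMaximal hb)
    have hzc : z = IsLocalRing.closedPoint (Y.X.presheaf.stalk q.point) := PrimeSpectrum.ext hmax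
    rw [← hz, hzc]
    exact Scheme.fromSpecStalk_closedPoint

/-- An element of `K` is integral at all but finitely many closed points. -/
theorem eventually_mem_completionIntegers (f : Y.functionField) :
    ∀ᶠ q : Y.ClosedPoint in Filter.cofinite, (f : completion q) ∈ completionIntegers q := by
  have : IsNoetherian Y.X :=
    { __ := LocallyOfFiniteType.isLocallyNoetherian Y.hom
      __ := QuasiCompact.compactSpace_of_compactSpace Y.hom }
  obtain ⟨U, hU, s, hs⟩ := Y.X.presheaf.exists_germ_eq f
  obtain ⟨T, hTfin, hTc, hTi, hT⟩ :=
    TopologicalSpace.NoetherianSpace.exists_finite_set_isClosed_irreducible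
      (s := ((U : Set Y.X))ᶜ) U.isOpen.isClosed_compl
  rw [Filter.eventually_cofinite]
  refine Set.Finite.of_finite_image (f := fun q : Y.ClosedPoint ↦ ({q.point} : Set Y.X))
    (hTfin.subset ?_) (fun a _ b _ hab ↦ by
      obtain ⟨a, ha⟩ := a
      obtain ⟨b, hb⟩ := b
      obtain rfl : a = b := Set.singleton_injective hab
      rfl)
  rintro _ ⟨q, hq, rfl⟩
  by_cases hqU : q.point ∈ U
  · exfalso
    apply hq
    have hf : f = algebraMap (localRing q) Y.functionField (Y.X.presheaf.germ U q.point hqU s) := by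
      have : Nonempty U := ⟨⟨_, hqU⟩⟩
      rw [Scheme.algebraMap_germ_eq_germToFunctionField, ← hs]
    rw [IsDedekindDomain.HeightOneSpectrum.mem_adicCompletionIntegers,
      IsDedekindDomain.HeightOneSpectrum.adicCompletion.valued_coe, hf]
    exact IsDedekindDomain.HeightOneSpectrum.valuation_le_one _ _
  · obtain ⟨t, htT, hqt⟩ : q.point ∈ ⋃₀ T := hT ▸ hqU
    obtain ⟨y, hy⟩ := QuasiSober.sober (hTi t htT) (hTc t htT)
    have hyq : y ⤳ q.point := by
      rw [specializes_iff_mem_closure, hy]; exact hqt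
    obtain rfl | rfl := eq_or_eq_genericPoint_of_specializes q hyq
    · change {q.point} ∈ T
      rwa [← q.isClosed.closure_eq, hy]
    · exfalso
      have : genericPoint Y.X ∈ ((U : Set Y.X))ᶜ := by
        rw [hT]
        exact ⟨t, htT, hy ▸ subset_closure rfl⟩
      exact this hU

/-- The diagonal embedding of `K` into the ring of adeles. -/
def diagonal : Y.functionField →+* Y.Adele where
  toFun f := ⟨fun q ↦ (f : completion q), Y.eventually_mem_completionIntegers f⟩
  map_one' := Subtype.ext <| funext fun q ↦
    IsDedekindDomain.HeightOneSpectrum.adicCompletion.coe_one _ (place q)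
  map_mul' f g := Subtype.ext <| funext fun q ↦
    IsDedekindDomain.HeightOneSpectrum.adicCompletion.coe_mul _ (place q) f g
  map_zero' := Subtype.ext <| funext fun q ↦
    IsDedekindDomain.HeightOneSpectrum.adicCompletion.coe_zero _ (place q)
  map_add' f g := Subtype.ext <| funext fun q ↦
    IsDedekindDomain.HeightOneSpectrum.adicCompletion.coe_add _ (place q) f g

/-- The image of `K` in the ring of adeles. -/
def principalAdeles : AddSubgroup Y.Adele := Y.diagonal.toAddMonoidHom.range

variable {Y} in
/-- `μ` is the product `∏ dx_q` of the measures `dx_q` on the `K_q`: a box `∏ B_q`, with Borel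
sets `B_q ⊆ K_q` that are the ring of integers of `K_q` for all `q` outside a finite set `S`, has
volume `∏_{q ∈ S} dx_q (B_q)`. (The rings of integers have volume one.) -/
def IsProductMeasure (dx : ∀ q : Y.ClosedPoint, Measure (completion q))
    (μ : Measure Y.Adele) : Prop :=
  ∀ (S : Finset Y.ClosedPoint) (B : ∀ q : Y.ClosedPoint, Set (completion q)),
    (∀ q, MeasurableSet (B q)) → (∀ q ∉ S, B q = completionIntegers q) →
      μ {a | ∀ q, a q ∈ B q} = ∏ q ∈ S, dx q (B q)

/-- The structure sheaf of `Y`, as a sheaf of abelian groups. -/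
def structureSheafAb :
    Sheaf (Opens.grothendieckTopology Y.X) AddCommGrpCat.{u} :=
  (sheafCompose _ (forget₂ CommRingCat.{u} RingCat.{u} ⋙ forget₂ RingCat.{u} AddCommGrpCat.{u})).obj
    Y.X.sheaf

/-- The constants: the ring homomorphism from `k` to the sections of the structure sheaf. -/
def constants (U : Y.X.Opens) : k →+* Γ(Y.X, U) :=
  (Y.X.presheaf.map (homOfLE le_top : U ⟶ ⊤).op).hom.comp
    (Y.hom.appTop.hom.comp (Scheme.ΓSpecIso (.of k)).inv.hom)

theorem map_constants {U V : (Y.X.Opens)ᵒᵖ} (i : U ⟶ V) (a : k) :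
    Y.X.presheaf.map i (Y.constants U.unop a) = Y.constants V.unop a := by
  simp only [constants, RingHom.comp_apply]
  rw [← CommRingCat.comp_apply, ← Y.X.presheaf.map_comp]
  rfl

/-- Multiplication by a constant, as an endomorphism of the structure sheaf. -/
def scalar (a : k) : Y.structureSheafAb ⟶ Y.structureSheafAb where
  hom :=
    { app := fun U ↦ AddCommGrpCat.ofHom (AddMonoidHom.mulLeft (Y.constants U.unop a))
      naturality := fun U V i ↦ by
        refine AddCommGrpCat.hom_ext (AddMonoidHom.ext fun (x : Γ(Y.X, U.unop)) ↦ ?_)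
        change Y.constants V.unop a * Y.X.presheaf.map i x =
          Y.X.presheaf.map i (Y.constants U.unop a * x)
        rw [map_mul, Y.map_constants] }

/-- `H¹(Y, 𝒪_Y)`. -/
abbrev H1 : Type u := Sheaf.H Y.structureSheafAb 1

theorem scalar_one : Y.scalar 1 = 𝟙 _ := by
  refine Sheaf.hom_ext (NatTrans.ext (funext fun U ↦
    AddCommGrpCat.hom_ext (AddMonoidHom.ext fun (x : Γ(Y.X, U.unop)) ↦ ?_)))
  change Y.constants U.unop 1 * x = x
  rw [map_one, one_mul]

theorem scalar_mul (a b : k) : Y.scalar (a * b) = Y.scalar b ≫ Y.scalar a := by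
  refine Sheaf.hom_ext (NatTrans.ext (funext fun U ↦
    AddCommGrpCat.hom_ext (AddMonoidHom.ext fun (x : Γ(Y.X, U.unop)) ↦ ?_)))
  change Y.constants U.unop (a * b) * x = Y.constants U.unop a * (Y.constants U.unop b * x)
  rw [map_mul, mul_assoc]

theorem scalar_add (a b : k) : Y.scalar (a + b) = Y.scalar a + Y.scalar b := by
  refine Sheaf.hom_ext (NatTrans.ext (funext fun U ↦
    AddCommGrpCat.hom_ext (AddMonoidHom.ext fun (x : Γ(Y.X, U.unop)) ↦ ?_)))
  change Y.constants U.unop (a + b) * x = Y.constants U.unop a * x + Y.constants U.unop b * x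
  rw [map_add, add_mul]

/-- `k` acts on `H¹(Y, 𝒪_Y)` through its action on the structure sheaf. -/
instance : Module k Y.H1 where
  smul a x := Sheaf.H.map (Y.scalar a) 1 x
  one_smul x := by
    change Sheaf.H.map (Y.scalar 1) 1 x = x
    rw [scalar_one, Sheaf.H.map_id_apply]
  mul_smul a b x := by
    change Sheaf.H.map (Y.scalar (a * b)) 1 x = _
    rw [scalar_mul, Sheaf.H.map_comp_apply]
    rfl
  smul_zero a := map_zero _
  smul_add a x y := map_add _ x y
  add_smul a b x := by
    change Sheaf.H.map (Y.scalar (a + b)) 1 x = _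
    rw [scalar_add, Sheaf.H.map_add_apply]
    rfl
  zero_smul x := by
    change Sheaf.H.map (Y.scalar 0) 1 x = 0
    have h := Y.scalar_add 0 0
    rw [add_zero, left_eq_add] at h
    rw [h, Sheaf.H.map_apply, Abelian.Ext.mk₀_zero, Abelian.Ext.comp_zero]

/-- The genus of `Y`, the dimension over `k` of `H¹(Y, 𝒪_Y)`. -/
def genus : ℕ := Module.finrank k Y.H1

end SmoothProjCurve

end

/-! Write `A` for the adeles and `Ô` for the integral adeles, a compact open subgroup of measure
one. The group `A` is a union of cosets of `K + Ô`, and each coset contributes `(K + Ô)/K ≅ Ô/(K ∩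
Ô)` to `A/K`. Hence the covolume is `[A : K + Ô] / #(K ∩ Ô)`, the quotient of the orders of `H¹(Y,
𝒪)` and `H⁰(Y, 𝒪)` (`addCovolume_eq_index_div_card`).

The denominator: a rational function that is regular at all closed points is a global section
(`exists_germToFunctionField_eq`). The ring of global sections is a finite field extension of the
perfect field `k`, and geometric irreducibility makes it equal to `k` (`bijective_constants`).

The numerator: in `0 → 𝒪 → K → K/𝒪 → 0` the constant sheaf `K` is flasque, because `Y` is
irreducible, so `H¹(Y, 𝒪)` is the cokernel of `K` in the global sections of `K/𝒪`. Such a section is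
a family of principal parts in `K_q/Ô_q`, almost all zero, so these sections form `A/Ô` and `H¹(Y,
𝒪) = A/(K + Ô)` (`exists_adele_to_H1`).

Finiteness of this index also gives compactness of `A/K`. It is proved without coherent cohomology.
Choose `t` with `K` finite separable over `k(t)`. Strong approximation in the integral closure of
`k[t]`, and then in that of `k[1/t]`, yields one adele `c` with `A = K + cÔ`
(`exists_eq_diagonal_add_mul`). So the compact set `cÔ` maps onto the discrete group `A/(K + Ô)`,
which is therefore finite (`finiteIndex_sup`).

The measure `μ` is the Haar measure with `μ(Ô) = 1`. Its values on boxes follow from uniqueness of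
Haar measure on finite products, and they determine it because the boxes form a π-system that
generates the Borel sets. -/

/-! ### Covolumes and indices in topological groups -/

section Covolume

open scoped Pointwise

/-- Factor the index along `V ≤ V + Γ ∩ U ≤ U`. The lower step is `Γ ∩ U`, as `Γ ∩ V = 0`; the upper
step is `(Γ + U)/(Γ + V)`, by the modular law `(Γ + V) ∩ U = V + Γ ∩ U`. -/
theorem relIndex_eq_relIndex_sup_mul_card_inf {G : Type*} [AddCommGroup G]
    (Γ U V : AddSubgroup G) (hVU : V ≤ U)
    (hdisj : Disjoint Γ V) :
    V.relIndex U = (Γ ⊔ V).relIndex (Γ ⊔ U) * Nat.card (Γ ⊓ U : AddSubgroup G) := by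
  have h1 : V.relIndex (V ⊔ Γ ⊓ U) = Nat.card (Γ ⊓ U : AddSubgroup G) := by
    rw [sup_comm, AddSubgroup.relIndex_sup_right, ← AddSubgroup.inf_relIndex_right,
      (hdisj.symm.mono_right inf_le_left).eq_bot, AddSubgroup.relIndex_bot_left]
  have h2 : (V ⊔ Γ ⊓ U).relIndex U = (Γ ⊔ V).relIndex (Γ ⊔ U) := by
    have e : Γ ⊔ U = U ⊔ (Γ ⊔ V) := by
      rw [sup_left_comm, sup_eq_left.mpr hVU]
    rw [e, AddSubgroup.relIndex_sup_right, ← AddSubgroup.inf_relIndex_right (Γ ⊔ V),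
      sup_comm Γ V, sup_inf_assoc_of_le _ hVU]
  rw [← h1, ← h2, mul_comm]
  exact (AddSubgroup.relIndex_mul_relIndex _ _ _ le_sup_left (sup_le hVU inf_le_right)).symm

variable {G : Type*} [AddCommGroup G] [TopologicalSpace G] [IsTopologicalAddGroup G]

/-- Modulo `Γ`, each of the finitely many cosets of `Γ + U` is the image of a translate of the
compact set `U`. -/
theorem compactSpace_quotient_of_finiteIndex (Γ U : AddSubgroup G)
    (hU : IsCompact (U : Set G)) (hfin : (Γ ⊔ U).FiniteIndex) : CompactSpace (G ⧸ Γ) := by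
  have hc : IsCompact (⋃ x : G ⧸ (Γ ⊔ U), (fun y : G ↦ (↑(x.out + y) : G ⧸ Γ)) '' (U : Set G)) :=
    isCompact_iUnion fun x ↦ hU.image
      (QuotientAddGroup.continuous_mk.comp (continuous_const_add x.out))
  refine ⟨?_⟩
  convert hc
  refine (Set.eq_univ_of_forall fun y ↦ ?_).symm
  obtain ⟨g, rfl⟩ := QuotientAddGroup.mk_surjective y
  have h : -(g : G ⧸ (Γ ⊔ U)).out + g ∈ Γ ⊔ U :=
    QuotientAddGroup.eq.mp (Quotient.out_eq (g : G ⧸ (Γ ⊔ U)))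
  obtain ⟨c, hc, v, hv, h⟩ := AddSubgroup.mem_sup.mp h
  refine Set.mem_iUnion.mpr ⟨(g : G ⧸ (Γ ⊔ U)), v, hv, QuotientAddGroup.eq.mpr ?_⟩
  have : -((g : G ⧸ (Γ ⊔ U)).out + v) + g = c := by
    rw [neg_add_rev, add_assoc, ← h]; abel
  rwa [this]

variable [MeasurableSpace G] [BorelSpace G]

theorem measure_iUnion_out_vadd (μ : Measure G) [μ.IsAddLeftInvariant] (W V : AddSubgroup G)
    (hVW : V ≤ W) (hV : IsOpen (V : Set G)) [W.FiniteIndex] :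
    μ (⋃ x : G ⧸ W, (x.out +ᵥ (V : Set G))) = W.index * μ V := by
  have : Fintype (G ⧸ W) := Fintype.ofFinite _
  rw [measure_iUnion]
  · simp [measure_vadd, AddSubgroup.index, Nat.card_eq_fintype_card]
  · intro x y hxy
    refine Set.disjoint_left.mpr ?_
    rintro _ ⟨a, ha, rfl⟩ ⟨b, hb, h⟩
    apply hxy
    rw [← x.out_eq, ← y.out_eq]
    refine QuotientAddGroup.eq.mpr ?_
    have h : y.out + b = x.out + a := h
    have : -x.out + y.out = a - b := by
      rw [neg_add_eq_iff_eq_add, ← add_sub_assoc, ← h, add_sub_cancel_right]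
    rw [this]
    exact hVW (sub_mem ha hb)
  · intro x
    exact (hV.vadd x.out).measurableSet

/-- With `x` running through representatives of `G/(Γ + V)`, every element is uniquely `x + γ + v`,
since `Γ ∩ V = 0`. So the translates `x + V` together form a fundamental domain. -/
theorem addCovolume_eq_index_mul (μ : Measure G) [μ.IsAddLeftInvariant] (Γ V : AddSubgroup G)
    [Countable Γ] (hV : IsOpen (V : Set G)) (hdisj : Disjoint Γ V) [(Γ ⊔ V).FiniteIndex] :
    addCovolume Γ G μ = (Γ ⊔ V).index * μ V := by
  have hfd : IsAddFundamentalDomain Γ (⋃ x : G ⧸ (Γ ⊔ V), (x.out +ᵥ (V : Set G))) μ := by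
    refine IsAddFundamentalDomain.mk' ?_ fun g ↦ ?_
    · exact (isOpen_iUnion fun x ↦ hV.vadd _).measurableSet.nullMeasurableSet
    · have h : -(g : G ⧸ (Γ ⊔ V)).out + g ∈ Γ ⊔ V :=
        QuotientAddGroup.eq.mp (Quotient.out_eq (g : G ⧸ (Γ ⊔ V)))
      obtain ⟨c, hc, v, hv, h⟩ := AddSubgroup.mem_sup.mp h
      refine ⟨⟨-c, neg_mem hc⟩, Set.mem_iUnion.mpr ⟨(g : G ⧸ (Γ ⊔ V)), v, hv, ?_⟩, ?_⟩
      · change (g : G ⧸ (Γ ⊔ V)).out + v = -c + g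
        rw [eq_neg_add_iff_add_eq, ← add_assoc, add_comm c, add_assoc, h, add_neg_cancel_left]
      · rintro ⟨d, hd⟩ hy
        obtain ⟨x, w, hw, hx⟩ := Set.mem_iUnion.mp hy
        have hx : x.out + w = d + g := hx
        obtain rfl : x = g := by
          rw [← x.out_eq]
          refine QuotientAddGroup.eq.mpr ?_
          have : -x.out + g = -d + w := by
            rw [neg_add_eq_iff_eq_add, add_left_comm, hx, neg_add_cancel_left]
          rw [this]
          exact add_mem (neg_mem (AddSubgroup.mem_sup_left hd)) (AddSubgroup.mem_sup_right hw)
        have h1 : c + d = w - v := by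
          have h2 : g = (g : G ⧸ (Γ ⊔ V)).out + (c + v) := by rw [h, add_neg_cancel_left]
          have h3 : w = d + (c + v) := by
            rw [eq_comm, ← add_right_inj (g : G ⧸ (Γ ⊔ V)).out, hx, add_left_comm, ← h2]
          rw [h3]; abel
        have h0 := (AddSubgroup.disjoint_def.mp hdisj) (add_mem hc hd) (h1 ▸ sub_mem hw hv)
        exact Subtype.ext (eq_neg_of_add_eq_zero_right h0)
  rw [hfd.covolume_eq_volume, measure_iUnion_out_vadd μ _ V le_sup_right hV]

theorem measure_eq_relIndex_mul (μ : Measure G) [μ.IsAddLeftInvariant] (U V : AddSubgroup G)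
    (hVU : V ≤ U) (hV : IsOpen (V : Set G)) (hfin : V.relIndex U ≠ 0) :
    μ U = V.relIndex U * μ V := by
  have : (V.addSubgroupOf U).FiniteIndex := ⟨hfin⟩
  have : Fintype (U ⧸ V.addSubgroupOf U) := Fintype.ofFinite _
  have hU : (U : Set G) =
      ⋃ x : U ⧸ V.addSubgroupOf U, ((x.out : G) +ᵥ (V : Set G)) := by
    ext g
    simp only [SetLike.mem_coe, Set.mem_iUnion]
    constructor
    · intro hg
      refine ⟨((⟨g, hg⟩ : U) : U ⧸ V.addSubgroupOf U), _, ?_, add_neg_cancel_left _ _⟩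
      exact AddSubgroup.mem_addSubgroupOf.mp (QuotientAddGroup.eq.mp
        (Quotient.out_eq ((⟨g, hg⟩ : U) : U ⧸ V.addSubgroupOf U)))
    · rintro ⟨x, v, hv, rfl⟩
      exact add_mem x.out.2 (hVU hv)
  rw [hU, measure_iUnion]
  · simp [measure_vadd, AddSubgroup.relIndex, AddSubgroup.index, Nat.card_eq_fintype_card]
  · intro x y hxy
    refine Set.disjoint_left.mpr ?_
    rintro _ ⟨a, ha, rfl⟩ ⟨b, hb, h⟩
    apply hxy
    rw [← x.out_eq, ← y.out_eq]
    refine QuotientAddGroup.eq.mpr ?_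
    have h : (y.out : G) + b = x.out + a := h
    have : -(x.out : G) + y.out = a - b := by
      rw [neg_add_eq_iff_eq_add, ← add_sub_assoc, ← h, add_sub_cancel_right]
    change -(x.out : G) + y.out ∈ V
    rw [this]
    exact sub_mem ha hb
  · intro x
    exact (hV.vadd (x.out : G)).measurableSet

/-- The covolume of a discrete cocompact subgroup `Γ`, from a compact open subgroup `U`. -/
theorem addCovolume_eq_index_div_card (μ : Measure G) [μ.IsAddLeftInvariant]
    (Γ U V : AddSubgroup G) [Countable Γ] (hU : IsCompact (U : Set G)) (hμ : μ U = 1)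
    (hVU : V ≤ U) (hV : IsOpen (V : Set G)) (hdisj : Disjoint Γ V) [(Γ ⊔ U).FiniteIndex] :
    addCovolume Γ G μ = (Γ ⊔ U).index / Nat.card (Γ ⊓ U : AddSubgroup G) := by
  -- `U` may meet `Γ`, so the fundamental domain is built from the smaller `V`, of finite index in
  -- the compact group `U`. The index formula then eliminates `V`.
  have hfin : V.relIndex U ≠ 0 := by
    have : CompactSpace U := isCompact_iff_compactSpace.mp hU
    have ho : IsOpen ((V.addSubgroupOf U : AddSubgroup U) : Set U) :=
      hV.preimage continuous_subtype_val
    have := AddSubgroup.quotient_finite_of_isOpen _ ho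
    exact AddSubgroup.index_ne_zero_of_finite (H := V.addSubgroupOf U)
  have h1 := measure_eq_relIndex_mul μ U V hVU hV hfin
  rw [hμ] at h1
  have h2 := relIndex_eq_relIndex_sup_mul_card_inf Γ U V hVU hdisj
  have hne := h2 ▸ hfin
  have h3 := AddSubgroup.relIndex_mul_index (sup_le_sup_left hVU Γ : Γ ⊔ V ≤ Γ ⊔ U)
  have : (Γ ⊔ V).FiniteIndex :=
    ⟨h3 ▸ mul_ne_zero (left_ne_zero_of_mul hne) AddSubgroup.FiniteIndex.index_ne_zero⟩
  rw [addCovolume_eq_index_mul μ Γ V hV hdisj, ← h3,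
    ENNReal.eq_div_iff (by exact_mod_cast right_ne_zero_of_mul hne) (ENNReal.natCast_ne_top _)]
  calc _ = ((Γ ⊔ U).index : ENNReal) * (((Γ ⊔ V).relIndex (Γ ⊔ U) *
        Nat.card (Γ ⊓ U : AddSubgroup G) : ℕ) * μ V) := by push_cast; ring
    _ = _ := by rw [← h2, ← h1, mul_one]

end Covolume

/-! ### Topology and Borel measures on restricted products -/

namespace RestrictedProduct

open Filter Topology

variable {ι : Type*} {R : ι → Type*} [∀ i, TopologicalSpace (R i)]

section Basis

variable {A : ∀ i, Set (R i)}

theorem isOpen_box (hA : ∀ i, IsOpen (A i)) {V : ∀ i, Set (R i)} (hV : ∀ i, IsOpen (V i))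
    {s : Set ι} (hs : s.Finite) (h : ∀ i ∉ s, V i = A i) :
    IsOpen {a : Πʳ i, [R i, A i] | ∀ i, a i ∈ V i} := by
  have h1 : {a : Πʳ i, [R i, A i] | ∀ i, a i ∈ V i} =
      {a | ∀ i, i ∉ s → a i ∈ A i} ∩ ⋂ i ∈ s, (fun a ↦ a i) ⁻¹' V i := by
    ext a
    simp only [Set.mem_ofPred_eq, Set.mem_inter_iff, Set.mem_iInter, Set.mem_preimage]
    constructor
    · exact fun ha ↦ ⟨fun i hi ↦ h i hi ▸ ha i, fun i _ ↦ ha i⟩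
    · rintro ⟨h1, h2⟩ i
      by_cases hi : i ∈ s
      · exact h2 i hi
      · exact h i hi ▸ h1 i hi
  rw [h1]
  exact (isOpen_forall_imp_mem hA).inter
    (hs.isOpen_biInter fun i _ ↦ (hV i).preimage (continuous_eval i))

theorem isCompact_setOf_forall_mem (hA : ∀ i, IsCompact (A i)) :
    IsCompact {a : Πʳ i, [R i, A i] | ∀ i, a i ∈ A i} := by
  have hc (i : ι) : CompactSpace (A i) := isCompact_iff_compactSpace.mp (hA i)
  have := isCompact_range (isEmbedding_structureMap (R := R) (A := A) (𝓕 := cofinite)).continuous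
  rwa [range_structureMap] at this

/-- The point `x` lies in the subproduct of elements that are integral wherever `x` is. Its topology
is induced from the full product, where finitely many coordinates describe a neighbourhood; the
other exceptional indices are the finitely many at which `x` is not integral. -/
theorem exists_box_subset (hA : ∀ i, IsOpen (A i)) {U : Set (Πʳ i, [R i, A i])} (hU : IsOpen U)
    {x : Πʳ i, [R i, A i]} (hx : x ∈ U) :
    ∃ (s : Finset ι) (V : ∀ i, Set (R i)), (∀ i, IsOpen (V i)) ∧ (∀ i ∉ s, V i = A i) ∧
      (∀ i, x i ∈ V i) ∧ {a : Πʳ i, [R i, A i] | ∀ i, a i ∈ V i} ⊆ U := by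
  classical
  let T : Set ι := {i | x i ∈ A i}
  have hT : cofinite ≤ 𝓟 T := le_principal_iff.mpr x.2
  have hTfin : (Tᶜ).Finite := mem_cofinite.mp x.2
  let x' : Πʳ i, [R i, A i]_[𝓟 T] := ⟨x.1, fun i hi ↦ hi⟩
  have hU' : IsOpen (inclusion R A hT ⁻¹' U) := hU.preimage (continuous_inclusion hT)
  obtain ⟨W, hW, hWU⟩ := isEmbedding_coe_of_principal.isOpen_iff.mp hU'
  have hxW : (x' : ∀ i, R i) ∈ W := by
    have : x' ∈ inclusion R A hT ⁻¹' U := hx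
    rwa [← hWU] at this
  obtain ⟨I, V, hV, hVW⟩ := isOpen_pi_iff.mp hW _ hxW
  refine ⟨I ∪ hTfin.toFinset,
    fun i ↦ (if i ∈ I then V i else Set.univ) ∩ (if i ∈ T then A i else Set.univ), ?_, ?_, ?_, ?_⟩
  · intro i
    refine IsOpen.inter ?_ ?_
    · split_ifs with h
      exacts [(hV i h).1, isOpen_univ]
    · split_ifs
      exacts [hA i, isOpen_univ]
  · intro i hi
    simp only [Finset.mem_union, Set.Finite.mem_toFinset, not_or, Set.mem_compl_iff,
      not_not] at hi
    simp [hi.1, hi.2]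
  · intro i
    refine ⟨?_, ?_⟩
    · split_ifs with h
      exacts [(hV i h).2, trivial]
    · split_ifs with h
      exacts [h, trivial]
  · intro a ha
    let a' : Πʳ i, [R i, A i]_[𝓟 T] := ⟨a.1, fun i hi ↦ by
      have := (ha i).2
      rwa [if_pos hi] at this⟩
    have : a' ∈ inclusion R A hT ⁻¹' U := by
      rw [← hWU]
      refine hVW fun i hi ↦ ?_
      have := (ha i).1
      rwa [if_pos (show i ∈ I from hi)] at this
    exact this

/-- The restricted product is a countable union of open subproducts, one for each finite set of
exceptional indices, and each of them embeds in a countable product. -/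
theorem secondCountableTopology [Countable ι] [∀ i, SecondCountableTopology (R i)]
    (hA : ∀ i, IsOpen (A i)) : SecondCountableTopology (Πʳ i, [R i, A i]) := by
  classical
  have hT (s : Finset ι) : cofinite ≤ 𝓟 ((s : Set ι)ᶜ) :=
    le_principal_iff.mpr s.finite_toSet.compl_mem_cofinite
  have h2 (s : Finset ι) :
      SecondCountableTopology (Set.range (inclusion R A (hT s))) := by
    have h := isOpenEmbedding_inclusion_principal hA (hT s)
    have : SecondCountableTopology (Πʳ i, [R i, A i]_[𝓟 ((s : Set ι)ᶜ)]) :=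
      isEmbedding_coe_of_principal.secondCountableTopology
    exact h.isEmbedding.toHomeomorph.symm.isEmbedding.secondCountableTopology
  refine TopologicalSpace.secondCountableTopology_of_countable_cover
    (fun s : Finset ι ↦ (isOpenEmbedding_inclusion_principal hA (hT s)).isOpen_range)
    (Set.eq_univ_of_forall fun x ↦ ?_)
  have hfin : {i | x i ∈ A i}ᶜ.Finite := mem_cofinite.mp x.2
  refine Set.mem_iUnion.mpr ⟨hfin.toFinset, ⟨x.1, ?_⟩, rfl⟩
  intro i hi
  by_contra h
  exact hi (hfin.mem_toFinset.mpr h)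

end Basis

section Boxes

variable {R : ι → Type*} {S : ι → Type*} [∀ i, SetLike (S i) (R i)] [∀ i, MeasurableSpace (R i)]

/-- The boxes `∏ E_i` with Borel sets `E_i` that are `B_i` for almost all `i`. -/
def boxes (B : ∀ i, S i) : Set (Set (Πʳ i, [R i, B i])) :=
  {s | ∃ (t : Finset ι) (E : ∀ i, Set (R i)), (∀ i, MeasurableSet (E i)) ∧
    (∀ i ∉ t, E i = B i) ∧ s = {a | ∀ i, a i ∈ E i}}

theorem isPiSystem_boxes (B : ∀ i, S i) : IsPiSystem (boxes B) := by
  classical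
  rintro _ ⟨t, E, hE, ht, rfl⟩ _ ⟨t', E', hE', ht', rfl⟩ -
  refine ⟨t ∪ t', fun i ↦ E i ∩ E' i, fun i ↦ (hE i).inter (hE' i), fun i hi ↦ ?_, ?_⟩
  · simp only [Finset.mem_union, not_or] at hi
    simp only [ht i hi.1, ht' i hi.2, Set.inter_self]
  · ext a
    exact forall_and.symm

end Boxes

section Measure

variable {S : ι → Type*} [∀ i, SetLike (S i) (R i)] {B : ∀ i, S i}
  [MeasurableSpace (Πʳ i, [R i, B i])] [BorelSpace (Πʳ i, [R i, B i])]

theorem generateFrom_boxes [∀ i, MeasurableSpace (R i)] [∀ i, BorelSpace (R i)] [Countable ι]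
    [∀ i, SecondCountableTopology (R i)]
    (hB : ∀ i, IsOpen (B i : Set (R i))) :
    ‹MeasurableSpace (Πʳ i, [R i, B i])› = MeasurableSpace.generateFrom (boxes B) := by
  refine le_antisymm ?_ (MeasurableSpace.generateFrom_le ?_)
  · have := secondCountableTopology (A := fun i ↦ (B i : Set (R i))) hB
    have hb : TopologicalSpace.IsTopologicalBasis {s : Set (Πʳ i, [R i, B i]) | IsOpen s ∧
        s ∈ boxes B} := by
      refine TopologicalSpace.isTopologicalBasis_of_isOpen_of_nhds (fun s hs ↦ hs.1) ?_
      intro x U hx hU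
      obtain ⟨t, V, hV, ht, hxV, hVU⟩ := exists_box_subset hB hU hx
      exact ⟨_, ⟨isOpen_box hB hV t.finite_toSet ht, t, V, fun i ↦ (hV i).measurableSet, ht, rfl⟩,
        hxV, hVU⟩
    rw [BorelSpace.measurable_eq (α := Πʳ i, [R i, B i]), hb.borel_eq_generateFrom]
    exact MeasurableSpace.generateFrom_mono fun s hs ↦ hs.2
  · rintro _ ⟨t, E, hE, ht, rfl⟩
    have : {a : Πʳ i, [R i, B i] | ∀ i, a i ∈ E i} = ⋂ i, (fun a ↦ a i) ⁻¹' E i := by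
      ext; simp
    rw [this]
    exact MeasurableSet.iInter fun i ↦ (continuous_eval i).measurable (hE i)

variable [∀ i, AddCommGroup (R i)] [∀ i, IsTopologicalAddGroup (R i)]
  [∀ i, AddSubgroupClass (S i) (R i)]

theorem exists_isAddHaarMeasure (hB : ∀ i, IsOpen (B i : Set (R i)))
    (hBc : ∀ i, IsCompact (B i : Set (R i))) :
    ∃ μ : Measure (Πʳ i, [R i, B i]), μ.IsAddLeftInvariant ∧ μ {a | ∀ i, a i ∈ B i} = 1 := by
  have : Fact (∀ i, IsOpen (B i : Set (R i))) := ⟨hB⟩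
  have hr := isCompact_setOf_forall_mem hBc
  let K : TopologicalSpace.PositiveCompacts (Πʳ i, [R i, B i]) :=
    ⟨⟨{a | ∀ i, a i ∈ B i}, hr⟩, by
      change (interior {a : Πʳ i, [R i, B i] | ∀ i, a i ∈ B i}).Nonempty
      have ho : IsOpen {a : Πʳ i, [R i, B i] | ∀ i, a i ∈ B i} := isOpen_forall_mem hB
      rw [ho.interior_eq]
      exact ⟨0, fun i ↦ zero_mem (B i)⟩⟩
  exact ⟨Measure.addHaarMeasure K, inferInstance, Measure.addHaarMeasure_self⟩

variable [∀ i, MeasurableSpace (R i)] [∀ i, BorelSpace (R i)]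

/-- A measure on a restricted product is determined by its values on boxes. -/
theorem ext_of_boxes [Countable ι] [∀ i, SecondCountableTopology (R i)]
    (hB : ∀ i, IsOpen (B i : Set (R i))) {μ ν : Measure (Πʳ i, [R i, B i])}
    (hμ : ∀ x : Πʳ i, [R i, B i], μ {a | ∀ i, a i - x i ∈ B i} ≠ ⊤)
    (h : ∀ s ∈ boxes B, μ s = ν s) : μ = ν := by
  have := secondCountableTopology (A := fun i ↦ (B i : Set (R i))) hB
  have : Nonempty (Πʳ i, [R i, B i]) := ⟨0⟩
  -- The translates of `∏ B_i` by a dense sequence are boxes of finite measure. They cover: a term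
  -- of the sequence in the open set `y + ∏ B_i` has `y` in its own translate, as `B_i = -B_i`.
  let x := TopologicalSpace.denseSeq (Πʳ i, [R i, B i])
  have hx (y : Πʳ i, [R i, B i]) :
      IsOpen {a : Πʳ i, [R i, B i] | ∀ i, a i - y i ∈ B i} ∧
      {a : Πʳ i, [R i, B i] | ∀ i, a i - y i ∈ B i} ∈ boxes B := by
    have ho (i : ι) : IsOpen {r : R i | r - y i ∈ B i} :=
      (hB i).preimage (continuous_sub_right (y i))
    have hfin : {i | y i ∈ B i}ᶜ.Finite := mem_cofinite.mp y.2
    have heq : ∀ i ∉ hfin.toFinset, {r : R i | r - y i ∈ B i} = B i := by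
      intro i hi
      have hi : y i ∈ B i := by simpa using hi
      ext r
      change r - y i ∈ B i ↔ r ∈ B i
      exact ⟨fun h ↦ sub_add_cancel r (y i) ▸ add_mem h hi, fun h ↦ sub_mem h hi⟩
    have heq' : ∀ i ∉ ({i | y i ∈ B i}ᶜ : Set ι), {r : R i | r - y i ∈ B i} = B i := by
      intro i hi
      exact heq i (by simpa using hi)
    exact ⟨isOpen_box hB ho hfin heq', hfin.toFinset, _, fun i ↦ (ho i).measurableSet, heq, rfl⟩
  refine Measure.ext_of_generateFrom_of_iUnion (boxes B)
    (fun n ↦ {a | ∀ i, a i - x n i ∈ B i}) (generateFrom_boxes hB) (isPiSystem_boxes B) ?_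
    (fun n ↦ (hx _).2) (fun n ↦ hμ _) h
  refine Set.eq_univ_of_forall fun y ↦ Set.mem_iUnion.mpr ?_
  obtain ⟨z, hz, n, rfl⟩ := (TopologicalSpace.denseRange_denseSeq (Πʳ i, [R i, B i])).inter_open_nonempty
    _ (hx y).1 ⟨y, fun i ↦ by rw [sub_self]; exact zero_mem _⟩
  refine ⟨n, fun i ↦ ?_⟩
  rw [← neg_sub]
  exact neg_mem (hz i)

/-- Restrict `μ` to the elements that are integral outside `t` and push it forward to the finite
product over `t`. The result is translation invariant with mass one on `∏ B_i`, so it is the product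
of the `dx i`. -/
theorem measure_box [∀ i, SecondCountableTopology (R i)] [∀ i, T2Space (R i)]
    [Countable ι] (hB : ∀ i, IsOpen (B i : Set (R i))) (hBc : ∀ i, IsCompact (B i : Set (R i)))
    (μ : Measure (Πʳ i, [R i, B i])) [μ.IsAddLeftInvariant] (hμ : μ {a | ∀ i, a i ∈ B i} = 1)
    (dx : ∀ i, Measure (R i)) [∀ i, (dx i).IsAddHaarMeasure] (hdx : ∀ i, dx i (B i) = 1)
    (t : Finset ι) (E : ∀ i, Set (R i)) (hE : ∀ i, MeasurableSet (E i))
    (ht : ∀ i ∉ t, E i = B i) : μ {a | ∀ i, a i ∈ E i} = ∏ i ∈ t, dx i (E i) := by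
  classical
  have : Fact (∀ i, IsOpen (B i : Set (R i))) := ⟨hB⟩
  have hLC (i : ι) : LocallyCompactSpace (R i) :=
    (hBc i).locallyCompactSpace_of_mem_nhds_of_addGroup ((hB i).mem_nhds (zero_mem (B i)))
  have := secondCountableTopology (A := fun i ↦ (B i : Set (R i))) hB
  let pr : (Πʳ i, [R i, B i]) → (∀ i : t, R i) := fun a i ↦ a i
  have hpr : Measurable pr := measurable_pi_iff.mpr fun i ↦ (continuous_eval i.1).measurable
  let F : Set (Πʳ i, [R i, B i]) := {a | ∀ i, i ∉ t → a i ∈ B i}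
  have hF : MeasurableSet F := (isOpen_forall_imp_mem hB).measurableSet
  let ν : Measure (∀ i : t, R i) := (μ.restrict F).map pr
  have hν {s : Set (∀ i : t, R i)} (hs : MeasurableSet s) : ν s = μ (pr ⁻¹' s ∩ F) := by
    rw [Measure.map_apply hpr hs, Measure.restrict_apply (hpr hs)]
  have hpi (E : ∀ i, Set (R i)) (hE : ∀ i, MeasurableSet (E i)) (ht : ∀ i ∉ t, E i = B i) :
      ν (Set.pi Set.univ fun i : t ↦ E i) = μ {a | ∀ i, a i ∈ E i} := by
    rw [hν (MeasurableSet.univ_pi fun i ↦ hE i)]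
    congr 1
    ext a
    simp only [Set.mem_inter_iff, Set.mem_preimage, Set.mem_univ_pi, Set.mem_ofPred_eq, F]
    constructor
    · rintro ⟨h1, h2⟩ i
      by_cases hi : i ∈ t
      · exact h1 ⟨i, hi⟩
      · rw [ht i hi]; exact h2 i hi
    · exact fun h ↦ ⟨fun i ↦ h i, fun i hi ↦ by have := h i; rwa [ht i hi] at this⟩
  have hinv : ν.IsAddLeftInvariant := by
    refine ⟨fun g ↦ Measure.ext fun s hs ↦ ?_⟩
    rw [Measure.map_apply (measurable_const_add g) hs, hν (measurable_const_add g hs), hν hs]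
    -- Extension of `g` by zero outside `t`, so that translation by `g'` preserves `F`.
    let g' : Πʳ i, [R i, B i] := ⟨fun i ↦ if h : i ∈ t then g ⟨i, h⟩ else 0, by
      refine Filter.mem_of_superset t.finite_toSet.compl_mem_cofinite fun i hi ↦ ?_
      have hi : i ∉ t := hi
      simp only [Set.mem_ofPred_eq, dif_neg hi]
      exact zero_mem (B i)⟩
    have hg1 (i : ι) (hi : i ∉ t) : g' i = 0 := dif_neg hi
    have hg2 (i : t) : g' i = g i := dif_pos i.2
    rw [← measure_preimage_add μ g' (pr ⁻¹' s ∩ F)]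
    congr 1
    ext a
    have h1 : g + pr a = pr (g' + a) := by
      funext i
      change g i + a i = g' i + a i
      rw [hg2]
    have h2 : a ∈ F ↔ g' + a ∈ F := by
      refine forall₂_congr fun i hi ↦ ?_
      change _ ↔ g' i + a i ∈ B i
      rw [hg1 i hi, zero_add]
    simp only [Set.mem_inter_iff, Set.mem_preimage, h1, h2]
  let K : TopologicalSpace.PositiveCompacts (∀ i : t, R i) :=
    ⟨⟨Set.pi Set.univ fun i : t ↦ (B i : Set (R i)), isCompact_univ_pi fun i ↦ hBc i⟩, by
      have ho : IsOpen (Set.pi Set.univ fun i : t ↦ (B i : Set (R i))) :=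
        isOpen_set_pi Set.finite_univ fun i _ ↦ hB i
      change (interior (Set.pi Set.univ fun i : t ↦ (B i : Set (R i)))).Nonempty
      rw [ho.interior_eq]
      exact ⟨0, fun i _ ↦ zero_mem (B i)⟩⟩
  have hνK : ν K = 1 := by
    rw [← hμ]
    exact hpi (fun i ↦ B i) (fun i ↦ (hB i).measurableSet) fun _ _ ↦ rfl
  have hHaar : ν.IsAddHaarMeasure :=
    Measure.isAddHaarMeasure_of_isCompact_nonempty_interior ν K K.isCompact K.interior_nonempty
      (by rw [hνK]; exact one_ne_zero) (by rw [hνK]; exact ENNReal.one_ne_top)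
  have hpiK : Measure.pi (fun i : t ↦ dx i) K = 1 := by
    change Measure.pi (fun i : t ↦ dx i) (Set.pi Set.univ fun i : t ↦ (B i : Set (R i))) = 1
    rw [Measure.pi_pi]
    exact Finset.prod_eq_one fun i _ ↦ hdx i
  have hνpi : ν = Measure.pi (fun i : t ↦ dx i) := by
    rw [Measure.addHaarMeasure_unique ν K, Measure.addHaarMeasure_unique (Measure.pi _) K,
      hνK, hpiK]
  rw [← hpi E hE ht, hνpi, Measure.pi_pi]
  exact Finset.prod_coe_sort t fun i ↦ dx i (E i)

end Measure

end RestrictedProduct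

/-! ### Adic completions with finite residue field -/

namespace IsDedekindDomain.HeightOneSpectrum

open scoped WithZero Valued

variable {R : Type*} [CommRing R] [IsDedekindDomain R] {K : Type*} [Field K] [Algebra R K]
  [IsFractionRing R K] (v : HeightOneSpectrum R)

theorem adicCompletion.coe_sub (x y : K) :
    ((x - y : K) : v.adicCompletion K) = (x : v.adicCompletion K) - (y : v.adicCompletion K) :=
  map_sub (algebraMap K (v.adicCompletion K)) x y

theorem isOpen_setOf_valued_lt {γ : ℤᵐ⁰} (hγ : γ ≠ 0) :
    IsOpen {x : v.adicCompletion K | Valued.v x < γ} := by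
  obtain ⟨y, rfl⟩ := v.valuedAdicCompletion_surjective K γ
  have := Valued.isOpen_ball (v.adicCompletion K) (Valued.v.restrict y)
  convert this using 1
  ext x
  simp only [Set.mem_ofPred_eq, Valuation.restrict_lt_iff]

theorem exists_valued_sub_coe_lt (x : v.adicCompletion K) {γ : ℤᵐ⁰} (hγ : γ ≠ 0) :
    ∃ f : K, Valued.v (x - (f : v.adicCompletion K)) < γ := by
  have ho : IsOpen {y : v.adicCompletion K | Valued.v (x - y) < γ} :=
    (v.isOpen_setOf_valued_lt hγ).preimage (continuous_const.sub continuous_id)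
  obtain ⟨f, hf⟩ := (denseRange_algebraMap K v).exists_mem_open ho
    ⟨x, by simpa using zero_lt_iff.mpr hγ⟩
  exact ⟨f, hf⟩

theorem exists_sub_coe_mem_adicCompletionIntegers (x : v.adicCompletion K) :
    ∃ f : K, x - (f : v.adicCompletion K) ∈ v.adicCompletionIntegers K := by
  obtain ⟨f, hf⟩ := v.exists_valued_sub_coe_lt x one_ne_zero
  exact ⟨f, hf.le⟩

/-- The residue field of the completion is a quotient of `R ⧸ v`: an integral element is
approximated modulo the maximal ideal first by an element of `K`, by density, and then by an element
of `R`. -/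
theorem finite_residueField_adicCompletionIntegers [Finite (R ⧸ v.asIdeal)] :
    Finite (IsLocalRing.ResidueField (v.adicCompletionIntegers K)) := by
  let φ : R →+* IsLocalRing.ResidueField (v.adicCompletionIntegers K) :=
    (IsLocalRing.residue _).comp (algebraMap R (v.adicCompletionIntegers K))
  have hmem (r : v.adicCompletionIntegers K) :
      IsLocalRing.residue _ r = 0 ↔ Valued.v (r : v.adicCompletion K) < 1 := by
    rw [IsLocalRing.residue_eq_zero_iff]
    exact Valuation.mem_maximalIdeal_iff (v.adicCompletion K) Valued.v
  have hφ (r : R) (hr : r ∈ v.asIdeal) : φ r = 0 := by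
    refine (hmem _).mpr ?_
    rw [algebraMap_adicCompletionIntegers_apply, adicCompletion.valued_coe]
    exact (v.valuation_lt_one_iff_mem r).mpr hr
  have hsurj : Function.Surjective φ := by
    intro x
    obtain ⟨x, rfl⟩ := IsLocalRing.residue_surjective x
    obtain ⟨f, hf⟩ := v.exists_valued_sub_coe_lt x.1 one_ne_zero
    have hf1 : v.valuation K f ≤ 1 := by
      rw [← adicCompletion.valued_coe, ← sub_sub_cancel x.1 (f : v.adicCompletion K)]
      exact (Valuation.map_sub _ _ _).trans (max_le x.2 hf.le)
    obtain ⟨r, hr⟩ := v.exists_valuation_sub_lt_of_integer hf1 1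
    refine ⟨r, ?_⟩
    rw [eq_comm, ← sub_eq_zero, RingHom.comp_apply, ← map_sub, hmem]
    change Valued.v (x.1 - (algebraMap R K r : v.adicCompletion K)) < 1
    have : x.1 - (algebraMap R K r : v.adicCompletion K) =
        (x.1 - (f : v.adicCompletion K)) - ((algebraMap R K r - f : K) : v.adicCompletion K) := by
      rw [adicCompletion.coe_sub]; ring
    rw [this]
    refine (Valuation.map_sub _ _ _).trans_lt (max_lt hf ?_)
    rw [adicCompletion.valued_coe]
    exact hr
  exact Finite.of_surjective (Ideal.Quotient.lift v.asIdeal φ hφ)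
    (Ideal.Quotient.lift_surjective_of_surjective _ hφ hsurj)

theorem isCompact_adicCompletionIntegers [Finite (R ⧸ v.asIdeal)] :
    IsCompact (v.adicCompletionIntegers K : Set (v.adicCompletion K)) := by
  let : (Valued.v : Valuation (v.adicCompletion K) ℤᵐ⁰).RankOne :=
    -- The base `2` of the real absolute value is arbitrary; any base greater than one would do.
    Valuation.IsRankOneDiscrete.rankOne _ (e := 2) (by norm_num)
  have h1 : IsDiscreteValuationRing 𝒪[v.adicCompletion K] :=
    inferInstanceAs (IsDiscreteValuationRing (v.adicCompletionIntegers K))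
  have h2 : Finite 𝓀[v.adicCompletion K] := v.finite_residueField_adicCompletionIntegers
  have h3 : CompleteSpace 𝒪[v.adicCompletion K] :=
    (Valued.isClosed_integer _).completeSpace_coe
  exact isCompact_iff_compactSpace.mpr
    (Valued.integer.compactSpace_iff_completeSpace_and_isDiscreteValuationRing_and_finite_residueField.mpr
      ⟨h3, h1, h2⟩)

/-- A countable value group makes the uniformity countably generated, and the countable field `K` is
dense. -/
theorem secondCountableTopology_adicCompletion [Countable K] :
    SecondCountableTopology (v.adicCompletion K) := by
  have : Countable ℤᵐ⁰ := inferInstanceAs (Countable (Option ℤ))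
  have : Countable (MonoidWithZeroHom.ofClass
      (Valued.v : Valuation (v.adicCompletion K) ℤᵐ⁰)).ValueGroup₀ :=
    MonoidWithZeroHom.ValueGroup₀.embedding_strictMono.injective.countable
  have : Countable (MonoidWithZeroHom.ofClass
      (Valued.v : Valuation (v.adicCompletion K) ℤᵐ⁰)).ValueGroup₀ˣ :=
    Units.val_injective.countable
  have : (nhds (0 : v.adicCompletion K)).IsCountablyGenerated :=
    (Valued.hasBasis_nhds_zero (v.adicCompletion K) ℤᵐ⁰).isCountablyGenerated
  have := IsUniformAddGroup.uniformity_countably_generated (α := v.adicCompletion K)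
  have : TopologicalSpace.SeparableSpace (v.adicCompletion K) :=
    ⟨_, Set.countable_range _, denseRange_algebraMap K v⟩
  exact UniformSpace.secondCountable_of_separable _

end IsDedekindDomain.HeightOneSpectrum

theorem IsDiscreteValuationRing.coe_mem_adicCompletionIntegers_iff {R : Type*} [CommRing R]
    [IsDomain R] [IsDiscreteValuationRing R] {K : Type*} [Field K] [Algebra R K]
    [IsFractionRing R K] (f : K) :
    (f : (maximalIdeal R).adicCompletion K) ∈ (maximalIdeal R).adicCompletionIntegers K ↔
      f ∈ Set.range (algebraMap R K) := by
  rw [IsDedekindDomain.HeightOneSpectrum.mem_adicCompletionIntegers,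
    IsDedekindDomain.HeightOneSpectrum.adicCompletion.valued_coe]
  refine ⟨exists_lift_of_le_one, ?_⟩
  rintro ⟨r, rfl⟩
  exact IsDedekindDomain.HeightOneSpectrum.valuation_le_one _ _

theorem Algebra.FiniteType.countable (R S : Type*) [CommRing R] [CommRing S] [Algebra R S]
    [Countable R] [Algebra.FiniteType R S] : Countable S := by
  obtain ⟨n, f, hf⟩ := Algebra.FiniteType.iff_quotient_mvPolynomial''.mp
    (inferInstance : Algebra.FiniteType R S)
  have : Countable (MvPolynomial (Fin n) R) := by
    rw [← Cardinal.mk_le_aleph0_iff]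
    refine MvPolynomial.cardinalMk_le_max_lift.trans ?_
    simp
  exact hf.countable

theorem RingHom.exists_ringEquiv_of_range_eq {A B C : Type*} [CommRing A] [CommRing B]
    [CommRing C] {f : A →+* C} {g : B →+* C} (hf : Function.Injective f)
    (hg : Function.Injective g) (h : f.range = g.range) :
    ∃ e : A ≃+* B, ∀ x, g (e x) = f x := by
  let ef := RingEquiv.ofBijective f.rangeRestrict
    ⟨fun _ _ h ↦ hf (congrArg Subtype.val h), f.rangeRestrict_surjective⟩
  let eg := RingEquiv.ofBijective g.rangeRestrict
    ⟨fun _ _ h ↦ hg (congrArg Subtype.val h), g.rangeRestrict_surjective⟩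
  refine ⟨ef.trans ((RingEquiv.subringCongr h).trans eg.symm), fun x ↦ ?_⟩
  exact congrArg Subtype.val (eg.apply_symm_apply (RingEquiv.subringCongr h (ef x)))

/-! ### Closed points, local rings and sections of the curve -/

namespace SmoothProjCurve

variable {k : Type u} [Field k] {Y : SmoothProjCurve k}

theorem ClosedPoint.ext {p q : Y.ClosedPoint} (h : p.point = q.point) : p = q := by
  cases p; cases q; congr

instance : JacobsonSpace Y.X := LocallyOfFiniteType.jacobsonSpace Y.hom

/-- Every nonempty open subset of a closed subset contains a closed point. -/
theorem exists_closedPoint_specializes {U : Y.X.Opens} {y : Y.X} (hy : y ∈ U) :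
    ∃ q : Y.ClosedPoint, q.point ∈ U ∧ y ⤳ q.point := by
  obtain ⟨q, ⟨hq, hqU⟩, hqc⟩ := nonempty_inter_closedPoints
    (Z := closure {y} ∩ (U : Set Y.X)) ⟨y, subset_closure rfl, hy⟩
    (isClosed_closure.isLocallyClosed.inter U.isOpen.isLocallyClosed)
  exact ⟨⟨q, hqc⟩, hqU, specializes_iff_mem_closure.mpr hq⟩

instance : Nonempty Y.ClosedPoint := by
  obtain ⟨y⟩ : Nonempty Y.X := inferInstance
  obtain ⟨q, -⟩ := exists_closedPoint_specializes (U := ⊤) (y := y) trivial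
  exact ⟨q⟩

theorem coe_mem_completionIntegers_iff (q : Y.ClosedPoint) (f : Y.functionField) :
    (f : completion q) ∈ completionIntegers q ↔
      f ∈ Set.range (algebraMap (localRing q) Y.functionField) :=
  IsDiscreteValuationRing.coe_mem_adicCompletionIntegers_iff f

/-- This quotient is the residue field at `q`, which is finite over `k` by the Nullstellensatz. -/
instance [Finite k] (q : Y.ClosedPoint) : Finite (localRing q ⧸ (place q).asIdeal) := by
  have : IsClosedImmersion (Y.X.fromSpecResidueField q.point) :=
    isClosed_singleton_iff_isClosedImmersion.mp q.isClosed
  have hfin : IsFinite (Y.X.fromSpecResidueField q.point ≫ Y.hom) :=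
    isFinite_iff_locallyOfFiniteType_of_jacobsonSpace.mpr inferInstance
  obtain ⟨φ, hφ⟩ := Spec.map_surjective (Y.X.fromSpecResidueField q.point ≫ Y.hom)
  rw [← hφ, IsFinite.SpecMap_iff] at hfin
  algebraize [φ.hom]
  have : Finite (CommRingCat.of k) := ‹Finite k›
  have : Finite (Y.X.residueField q.point) :=
    Module.finite_of_finite (CommRingCat.of k)
  exact this

instance [Finite k] : Countable Y.functionField := by
  obtain ⟨y⟩ : Nonempty Y.X := inferInstance
  obtain ⟨_, ⟨U, hU, rfl⟩, hyU, -⟩ :=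
    Y.X.isBasis_affineOpens.exists_subset_of_mem_open (Set.mem_univ y) isOpen_univ
  have : Nonempty U := ⟨⟨_, hyU⟩⟩
  have h := Y.hom.finiteType_appLE (isAffineOpen_top _) hU (by simp)
  algebraize [(Y.hom.appLE ⊤ U (by simp)).hom]
  have : Countable Γ(Spec (.of k), ⊤) :=
    (Scheme.ΓSpecIso (.of k)).commRingCatIsoToRingEquiv.injective.countable
      (β := k)
  have : Countable Γ(Y.X, U) := Algebra.FiniteType.countable Γ(Spec (.of k), ⊤) _
  have := functionField_isFractionRing_of_isAffineOpen Y.X U hU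
  refine Function.Surjective.countable
    (f := fun x : Γ(Y.X, U) × Γ(Y.X, U) ↦
      algebraMap _ Y.functionField x.1 / algebraMap _ Y.functionField x.2) fun f ↦ ?_
  obtain ⟨a, b, -, rfl⟩ := IsFractionRing.div_surjective Γ(Y.X, U) f
  exact ⟨(a, b), rfl⟩

/-- Every closed point is a pole of some element of the countable field `K`, and each element has
finitely many poles. -/
instance [Finite k] : Countable Y.ClosedPoint := by
  have h (f : Y.functionField) : {q : Y.ClosedPoint | (f : completion q) ∉
      completionIntegers q}.Finite := Y.eventually_mem_completionIntegers f
  rw [← Set.countable_univ_iff]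
  refine (Set.countable_iUnion fun f ↦ (h f).countable).mono fun q _ ↦ ?_
  obtain ⟨f, hf⟩ : ∃ f : Y.functionField, f ∉ Set.range (algebraMap (localRing q) _) := by
    by_contra! hc
    exact IsDiscreteValuationRing.not_isField (localRing q)
      ((MulEquiv.ofBijective (algebraMap (localRing q) Y.functionField)
        ⟨IsFractionRing.injective _ _, hc⟩).isField (Field.toIsField _))
  exact Set.mem_iUnion.mpr ⟨f, fun h ↦ hf ((coe_mem_completionIntegers_iff q f).mp h)⟩

theorem isCompact_completionIntegers [Finite k] (q : Y.ClosedPoint) :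
    IsCompact (completionIntegers q : Set (completion q)) :=
  (place q).isCompact_adicCompletionIntegers

theorem isOpen_completionIntegers (q : Y.ClosedPoint) :
    IsOpen (completionIntegers q : Set (completion q)) :=
  Valued.isOpen_valuationSubring _

instance [Finite k] (q : Y.ClosedPoint) : SecondCountableTopology (completion q) :=
  (place q).secondCountableTopology_adicCompletion

/-- An element of the function field that is regular at all closed points of an open set is
a section over this open set. -/
theorem exists_germToFunctionField_eq {U : Y.X.Opens} [Nonempty U] (f : Y.functionField)
    (hf : ∀ q : Y.ClosedPoint, q.point ∈ U → (f : completion q) ∈ completionIntegers q) :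
    ∃ s : Γ(Y.X, U), Y.X.germToFunctionField U s = f := by
  have h (q : {q : Y.ClosedPoint // q.point ∈ U}) : ∃ (V : Y.X.Opens) (_ : V ≤ U)
      (hq : q.1.point ∈ V) (s : Γ(Y.X, V)), haveI : Nonempty V := ⟨⟨_, hq⟩⟩
        Y.X.germToFunctionField V s = f := by
    obtain ⟨a, ha⟩ := (coe_mem_completionIntegers_iff q.1 f).mp (hf q q.2)
    obtain ⟨V, hV, s, rfl⟩ := Y.X.presheaf.exists_germ_eq a
    have : Nonempty (U ⊓ V : Y.X.Opens) := ⟨⟨_, q.2, hV⟩⟩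
    refine ⟨U ⊓ V, inf_le_left, ⟨q.2, hV⟩,
      Y.X.presheaf.map (homOfLE inf_le_right).op s, ?_⟩
    rw [← ha, TopCat.Presheaf.germ_res_apply]
    have : Nonempty V := ⟨⟨_, hV⟩⟩
    rw [Scheme.algebraMap_germ_eq_germToFunctionField]
  choose V hVU hqV s hs using h
  -- Neighbourhoods of the closed points suffice: each point of `U` specializes to a closed point in
  -- `U`, and open sets are stable under generization.
  have hcov : U ≤ iSup V := by
    intro y hy
    obtain ⟨q, hq, hyq⟩ := exists_closedPoint_specializes hy
    exact TopologicalSpace.Opens.mem_iSup.mpr ⟨⟨q, hq⟩, hyq.mem_open (V _).isOpen (hqV ⟨q, hq⟩)⟩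
  have hne (q) : Nonempty (V q) := ⟨⟨_, hqV q⟩⟩
  have hgen (W : Y.X.Opens) [hW : Nonempty W] : genericPoint Y.X ∈ W :=
    ((genericPoint_spec Y.X).mem_open_set_iff W.isOpen).mpr (by simpa using hW)
  obtain ⟨t, ht, -⟩ := Y.X.sheaf.existsUnique_gluing' V U (fun q ↦ homOfLE (hVU q)) hcov s (by
    intro p q
    have : Nonempty (V p ⊓ V q : Y.X.Opens) := ⟨⟨_, hgen (V p), hgen (V q)⟩⟩
    refine Y.X.germToFunctionField_injective (V p ⊓ V q) ?_
    have h1 := hs p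
    have h2 := hs q
    rw [Scheme.germToFunctionField] at h1 h2 ⊢
    change Y.X.presheaf.germ _ _ _ (Y.X.presheaf.map (TopologicalSpace.Opens.infLELeft _ _).op (s p)) =
      Y.X.presheaf.germ _ _ _ (Y.X.presheaf.map (TopologicalSpace.Opens.infLERight _ _).op (s q))
    rw [TopCat.Presheaf.germ_res_apply, TopCat.Presheaf.germ_res_apply, h1, h2])
  refine ⟨t, ?_⟩
  obtain ⟨q, hq, -⟩ := exists_closedPoint_specializes (hgen U)
  rw [← hs ⟨q, hq⟩, ← ht ⟨q, hq⟩, Scheme.germToFunctionField, Scheme.germToFunctionField]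
  exact (TopCat.Presheaf.germ_res_apply ..).symm

theorem coe_germToFunctionField_mem_completionIntegers {U : Y.X.Opens} [Nonempty U]
    (s : Γ(Y.X, U)) (q : Y.ClosedPoint) (hq : q.point ∈ U) :
    ((Y.X.germToFunctionField U s : Y.functionField) : completion q) ∈ completionIntegers q := by
  rw [coe_mem_completionIntegers_iff]
  exact ⟨_, Scheme.algebraMap_germ_eq_germToFunctionField Y.X hq s⟩

/-- A closed point is determined by its local ring in the function field. -/
theorem eq_of_range_algebraMap_eq (p q : Y.ClosedPoint)
    (h : (algebraMap (localRing p) Y.functionField).range =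
      (algebraMap (localRing q) Y.functionField).range) : p = q := by
  have hp : Function.Injective (algebraMap (localRing p) Y.functionField) :=
    IsFractionRing.injective _ _
  have hq : Function.Injective (algebraMap (localRing q) Y.functionField) :=
    IsFractionRing.injective _ _
  obtain ⟨e, he⟩ := RingHom.exists_ringEquiv_of_range_eq hq hp h.symm
  let φp := Y.X.presheaf.stalkSpecializes (genericPoint_specializes p.point)
  let φq := Y.X.presheaf.stalkSpecializes (genericPoint_specializes q.point)
  let ε : Y.X.presheaf.stalk q.point ⟶ Y.X.presheaf.stalk p.point := CommRingCat.ofHom e.toRingHom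
  have hφ : ε ≫ φp = φq := by
    ext x
    exact he x
  -- Both morphisms `Spec 𝒪_p → Y` restrict to the generic point of `Y`. As `Y` is separated over
  -- `k` and `Spec K → Spec 𝒪_p` is dominant, they agree; their values at the closed point are `p`
  -- and `q`.
  have hι : Spec.map φp ≫ Y.X.fromSpecStalk p.point =
      Spec.map φp ≫ Spec.map ε ≫ Y.X.fromSpecStalk q.point := by
    rw [← Category.assoc, ← Spec.map_comp, hφ, Scheme.SpecMap_stalkSpecializes_fromSpecStalk,
      Scheme.SpecMap_stalkSpecializes_fromSpecStalk]
  have hdom : IsDominant (Spec.map φp) := by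
    refine ⟨(PrimeSpectrum.denseRange_comap_iff_ker_le_nilRadical φp.hom).mpr ?_⟩
    have hker : RingHom.ker φp.hom = ⊥ := (RingHom.injective_iff_ker_eq_bot _).mp hp
    rw [hker]
    exact bot_le
  have hk : Y.X.fromSpecStalk p.point ≫ Y.hom =
      (Spec.map ε ≫ Y.X.fromSpecStalk q.point) ≫ Y.hom := by
    obtain ⟨a, ha⟩ := Spec.map_surjective (Y.X.fromSpecStalk p.point ≫ Y.hom)
    obtain ⟨b, hb⟩ := Spec.map_surjective ((Spec.map ε ≫ Y.X.fromSpecStalk q.point) ≫ Y.hom)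
    have hab : Spec.map (a ≫ φp) = Spec.map (b ≫ φp) := by
      rw [Spec.map_comp, Spec.map_comp, ha, hb, ← Category.assoc, hι]
      simp only [Category.assoc]
    rw [← ha, ← hb]
    congr 1
    ext x
    exact hp congr(($(Spec.map_injective hab)).hom x)
  let c := IsLocalRing.closedPoint (Y.X.presheaf.stalk p.point)
  have hc : Spec.map ε c = IsLocalRing.closedPoint (Y.X.presheaf.stalk q.point) :=
    have : IsLocalHom e.toRingHom := ⟨fun a ha ↦ (isUnit_map_iff e a).mp ha⟩
    IsLocalRing.comap_closedPoint e.toRingHom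
  have h1 : Y.X.fromSpecStalk p.point c = p.point := Scheme.fromSpecStalk_closedPoint
  have h2 : Y.X.fromSpecStalk q.point (Spec.map ε c) = q.point := by
    rw [hc]
    exact Scheme.fromSpecStalk_closedPoint
  have h3 : Y.X.fromSpecStalk p.point c = Y.X.fromSpecStalk q.point (Spec.map ε c) :=
    congr($(ext_of_isDominant_of_isSeparated Y.hom hk (Spec.map φp) hι) c)
  exact ClosedPoint.ext (h1.symm.trans (h3.trans h2))

end SmoothProjCurve

/-! ### The connecting homomorphism and flasque sheaves -/

section SheafCohomology

open TopologicalSpace Opposite Limits Abelian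

variable {X : TopCat.{u}}

/-- A complex of abelian sheaves that is left exact on sections and locally right exact is a
short exact sequence. -/
theorem TopCat.Sheaf.shortExact_of_sections {S : ShortComplex (TopCat.Sheaf AddCommGrpCat.{u} X)}
    (hf : ∀ U : Opens X, Function.Injective (S.f.hom.app (op U)))
    (hfg : ∀ (U : Opens X) (s : S.X₂.obj.obj (op U)), S.g.hom.app (op U) s = 0 →
      ∃ t, S.f.hom.app (op U) t = s)
    (hg : TopCat.Presheaf.IsLocallySurjective S.g.hom) : S.ShortExact := by
  have hmono : Mono S.f := by
    have (U : (Opens X)ᵒᵖ) : Mono (S.f.hom.app U) :=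
      (AddCommGrpCat.mono_iff_injective _).mpr (hf U.unop)
    have : Mono S.f.hom := NatTrans.mono_of_mono_app _
    exact CategoryTheory.Sheaf.Hom.mono_of_presheaf_mono _ _ _
  have hepi : Epi S.g := (CategoryTheory.Sheaf.isLocallySurjective_iff_epi' _ S.g).mp hg
  refine ShortComplex.ShortExact.mk ?_
  rw [TopCat.Sheaf.exact_iff_stalkFunctor_map_exact]
  intro x
  rw [ShortComplex.ab_exact_iff]
  intro z hz
  obtain ⟨U, hxU, s, rfl⟩ := S.X₂.presheaf.exists_germ_eq z
  have hz : S.X₃.presheaf.germ U x hxU (S.g.hom.app (op U) s) =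
      S.X₃.presheaf.germ U x hxU 0 := by
    rw [map_zero, ← TopCat.Presheaf.stalkFunctor_map_germ_apply]
    exact hz
  obtain ⟨W, hxW, i₁, i₂, h⟩ := S.X₃.presheaf.germ_eq x hxU hxU _ _ hz
  obtain ⟨t, ht⟩ := hfg W (S.X₂.obj.map i₁.op s) (by
    rw [NatTrans.naturality_apply S.g.hom]
    exact h.trans (map_zero _))
  refine ⟨S.X₁.presheaf.germ W x hxW t, ?_⟩
  refine (TopCat.Presheaf.stalkFunctor_map_germ_apply W x hxW S.f.hom t).trans ?_
  rw [ht]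
  exact TopCat.Presheaf.germ_res_apply ..

variable {S : ShortComplex (CategoryTheory.Sheaf (Opens.grothendieckTopology X) AddCommGrpCat.{u})}

/-- The connecting homomorphism from global sections to the first cohomology. -/
noncomputable def CategoryTheory.ShortComplex.ShortExact.globalSectionsδ (hS : S.ShortExact) :
    S.X₃.obj.obj (Opposite.op ⊤) →+ CategoryTheory.Sheaf.H S.X₁ 1 :=
  (hS.extClass.postcomp _ (zero_add 1)).comp
    (CategoryTheory.Sheaf.H.equiv₀ S.X₃ isTerminalTop).symm.toAddMonoidHom

theorem CategoryTheory.ShortComplex.ShortExact.globalSectionsδ_eq_zero_iff (hS : S.ShortExact)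
    (s : S.X₃.obj.obj (Opposite.op ⊤)) :
    hS.globalSectionsδ s = 0 ↔ ∃ t, S.g.hom.app (Opposite.op ⊤) t = s := by
  constructor
  · intro h
    obtain ⟨x, hx⟩ := Ext.covariant_sequence_exact₃ _ hS _ (zero_add 1) h
    refine ⟨CategoryTheory.Sheaf.H.equiv₀ S.X₂ isTerminalTop x, ?_⟩
    rw [CategoryTheory.Sheaf.H.equiv₀_naturality, CategoryTheory.Sheaf.H.map_apply, hx]
    exact AddEquiv.apply_symm_apply _ _
  · rintro ⟨t, rfl⟩
    change ((CategoryTheory.Sheaf.H.equiv₀ S.X₃ isTerminalTop).symm _).comp hS.extClass (zero_add 1) = 0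
    rw [← CategoryTheory.Sheaf.H.equiv₀_symm_naturality, CategoryTheory.Sheaf.H.map_apply]
    simp only [Ext.comp_assoc_of_second_deg_zero, ShortComplex.ShortExact.comp_extClass,
      Ext.comp_zero]

theorem CategoryTheory.ShortComplex.ShortExact.globalSectionsδ_surjective (hS : S.ShortExact)
    (h : Subsingleton (CategoryTheory.Sheaf.H S.X₂ 1)) :
    Function.Surjective hS.globalSectionsδ := by
  intro x
  obtain ⟨y, hy⟩ := Ext.covariant_sequence_exact₁ _ hS x (Subsingleton.elim _ _) (zero_add 1)
  refine ⟨CategoryTheory.Sheaf.H.equiv₀ S.X₃ isTerminalTop y, ?_⟩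
  change ((CategoryTheory.Sheaf.H.equiv₀ S.X₃ isTerminalTop).symm _).comp hS.extClass (zero_add 1) = x
  rw [AddEquiv.symm_apply_apply, hy]

/-- The first cohomology of a flasque sheaf vanishes. -/
theorem TopCat.Sheaf.IsFlasque.subsingleton_H_one
    (F : CategoryTheory.Sheaf (Opens.grothendieckTopology X) AddCommGrpCat.{u})
    (hF : TopCat.Presheaf.IsFlasque F.obj) : Subsingleton (CategoryTheory.Sheaf.H F 1) := by
  -- For an embedding of `F` into an injective sheaf the connecting map onto `H¹` is surjective. It
  -- is also zero, because flasqueness of `F` lets global sections of the quotient lift.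
  let S := ShortComplex.mk (Injective.ι F) (cokernel.π (Injective.ι F)) (cokernel.condition _)
  have hS : S.ShortExact := ShortComplex.ShortExact.mk (ShortComplex.exact_cokernel _)
  have : TopCat.Sheaf.IsFlasque (X := X) S.X₁ := hF
  have hI : Injective S.X₂ := inferInstanceAs (Injective (Injective.under F))
  have hepi := TopCat.Sheaf.IsFlasque.epi_of_shortExact (X := X) (U := ⊤) hS
  have hsurj := (AddCommGrpCat.epi_iff_surjective _).mp hepi
  refine subsingleton_of_forall_eq 0 fun x ↦ ?_
  obtain ⟨s, rfl⟩ := hS.globalSectionsδ_surjective inferInstance x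
  exact (hS.globalSectionsδ_eq_zero_iff s).mpr (hsurj s)

end SheafCohomology

/-! ### Sheaves of functions defined by local predicates -/

section SheafOfFunctions

open TopologicalSpace TopCat

variable {X : TopCat.{u}} {T : X → Type u} [∀ x, AddCommGroup (T x)]

/-- A local predicate that is stable under the group operations. -/
structure TopCat.LocalPredicate.IsAdditive (P : LocalPredicate T) : Prop where
  zero (U : Opens X) : P.pred (U := U) 0
  add {U : Opens X} {f g : ∀ x : U, T x} : P.pred f → P.pred g → P.pred (f + g)
  neg {U : Opens X} {f : ∀ x : U, T x} : P.pred f → P.pred (-f)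

namespace TopCat.LocalPredicate.IsAdditive

variable {P : LocalPredicate T} (hP : P.IsAdditive)

/-- The group of functions on an open set that satisfy an additive local predicate. -/
def sections (U : Opens X) : AddSubgroup (∀ x : U, T x) where
  carrier := {f | P.pred f}
  zero_mem' := hP.zero U
  add_mem' := hP.add
  neg_mem' := hP.neg

/-- The presheaf of abelian groups of functions that satisfy an additive local predicate. -/
def presheaf : (Opens X)ᵒᵖ ⥤ AddCommGrpCat.{u} where
  obj U := AddCommGrpCat.of (hP.sections U.unop)
  map i := AddCommGrpCat.ofHom
    { toFun f := ⟨fun x ↦ f.1 (i.unop x), P.res i.unop f.1 f.2⟩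
      map_zero' := rfl
      map_add' _ _ := rfl }

/-- The sheaf of abelian groups of functions that satisfy an additive local predicate. -/
def sheaf : CategoryTheory.Sheaf (Opens.grothendieckTopology X) AddCommGrpCat.{u} :=
  ⟨hP.presheaf, by
    refine (TopCat.Presheaf.isSheaf_iff_isSheaf_comp (CategoryTheory.forget AddCommGrpCat.{u})
      hP.presheaf).mpr ?_
    refine TopCat.Presheaf.isSheaf_of_iso ?_ (subpresheafToTypes.isSheaf P)
    exact NatIso.ofComponents (fun U ↦ Iso.refl _)⟩

end TopCat.LocalPredicate.IsAdditive

end SheafOfFunctions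

/-! ### The exact sequence of principal parts -/

namespace SmoothProjCurve

open TopologicalSpace

variable {k : Type u} [Field k] (Y : SmoothProjCurve k)

theorem genericPoint_mem {U : Y.X.Opens} {x : Y.X} (hx : x ∈ U) : genericPoint Y.X ∈ U :=
  (genericPoint_specializes x).mem_open U.isOpen hx

/-- The predicate of being a constant function with values in the function field. -/
def isConstant : TopCat.LocalPredicate fun _ : Y.X ↦ Y.functionField where
  pred f := ∃ c, ∀ x, f x = c
  res i _ := fun ⟨c, hc⟩ ↦ ⟨c, fun x ↦ hc (i x)⟩
  locality {U} f hf := by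
    by_cases hU : Nonempty U
    · obtain ⟨x⟩ := hU
      -- The generic point lies in every nonempty open set, so the local constants all equal the
      -- value there.
      refine ⟨f ⟨genericPoint Y.X, Y.genericPoint_mem x.2⟩, fun y ↦ ?_⟩
      obtain ⟨V, hyV, i, c, hc⟩ := hf y
      exact (hc ⟨y, hyV⟩).trans (hc ⟨genericPoint Y.X, Y.genericPoint_mem hyV⟩).symm
    · exact ⟨0, fun x ↦ (hU ⟨x⟩).elim⟩

theorem isConstant_isAdditive : Y.isConstant.IsAdditive where
  zero _ := ⟨0, fun _ ↦ rfl⟩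
  add := by
    rintro U f g ⟨c, hc⟩ ⟨d, hd⟩
    exact ⟨c + d, fun x ↦ congrArg₂ (· + ·) (hc x) (hd x)⟩
  neg := by
    rintro U f ⟨c, hc⟩
    exact ⟨-c, fun x ↦ congrArg (- ·) (hc x)⟩

/-- The constant sheaf of rational functions. -/
noncomputable def functionSheaf : CategoryTheory.Sheaf (Opens.grothendieckTopology Y.X) AddCommGrpCat.{u} :=
  Y.isConstant_isAdditive.sheaf

theorem isFlasque_functionSheaf : TopCat.Presheaf.IsFlasque (X := Y.X) Y.functionSheaf.obj where
  epi {U V} i := by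
    refine (AddCommGrpCat.epi_iff_surjective _).mpr ?_
    rintro ⟨f, c, hc⟩
    exact ⟨⟨fun _ ↦ c, c, fun _ ↦ rfl⟩, Subtype.ext (funext fun x ↦ (hc x).symm)⟩

variable {Y} in
/-- The principal parts at `q`, that is, elements of `K_q` up to integral ones. -/
abbrev PrincipalPart (q : Y.ClosedPoint) : Type u :=
  completion q ⧸ (completionIntegers q).toSubring.toAddSubgroup

/-- The predicate of being a family of principal parts that is given by rational functions,
locally on `Y`. -/
def isPrincipalPart : TopCat.LocalPredicate fun x : Y.X ↦
    ∀ q : {q : Y.ClosedPoint // q.point = x}, PrincipalPart q.1 :=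
  TopCat.PrelocalPredicate.sheafify
    { pred s := ∃ f : Y.functionField, ∀ x q, s x q = ((f : completion q.1) : PrincipalPart q.1)
      res i _ := fun ⟨f, hf⟩ ↦ ⟨f, fun x ↦ hf (i x)⟩ }

variable {Y} in
theorem coe_add_completion (q : Y.ClosedPoint) (f g : Y.functionField) :
    ((f + g : Y.functionField) : completion q) = (f : completion q) + (g : completion q) :=
  IsDedekindDomain.HeightOneSpectrum.adicCompletion.coe_add _ (place q) f g

variable {Y} in
theorem coe_neg_completion (q : Y.ClosedPoint) (f : Y.functionField) :
    ((-f : Y.functionField) : completion q) = -(f : completion q) :=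
  map_neg (algebraMap Y.functionField (completion q)) f

variable {Y} in
theorem coe_sub_completion (q : Y.ClosedPoint) (f g : Y.functionField) :
    ((f - g : Y.functionField) : completion q) = (f : completion q) - (g : completion q) :=
  map_sub (algebraMap Y.functionField (completion q)) f g

theorem isPrincipalPart_isAdditive : Y.isPrincipalPart.IsAdditive where
  zero U x := ⟨U, x.2, 𝟙 U, 0, fun x q ↦ by
    rw [IsDedekindDomain.HeightOneSpectrum.adicCompletion.coe_zero]; rfl⟩
  add := by
    intro U s t hs ht x
    obtain ⟨V, hxV, i, f, hf⟩ := hs x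
    obtain ⟨W, hxW, j, g, hg⟩ := ht x
    refine ⟨V ⊓ W, ⟨hxV, hxW⟩, homOfLE (inf_le_left.trans i.le), f + g, fun y q ↦ ?_⟩
    rw [coe_add_completion, QuotientAddGroup.mk_add]
    exact congrArg₂ (· + ·) (hf ⟨y, y.2.1⟩ q) (hg ⟨y, y.2.2⟩ q)
  neg := by
    intro U s hs x
    obtain ⟨V, hxV, i, f, hf⟩ := hs x
    refine ⟨V, hxV, i, -f, fun y q ↦ ?_⟩
    rw [coe_neg_completion, QuotientAddGroup.mk_neg]
    exact congrArg (- ·) (hf y q)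

/-- The sheaf of principal parts. -/
noncomputable def principalPartSheaf : CategoryTheory.Sheaf (Opens.grothendieckTopology Y.X) AddCommGrpCat.{u} :=
  Y.isPrincipalPart_isAdditive.sheaf

/-- The inclusion of the structure sheaf into the sheaf of rational functions. -/
noncomputable def toFunctionSheaf : Y.structureSheafAb ⟶ Y.functionSheaf where
  hom :=
    { app U := AddCommGrpCat.ofHom
        { toFun (s : Γ(Y.X, U.unop)) :=
            ⟨fun x ↦ algebraMap (Y.X.presheaf.stalk x.1) Y.functionField
              (Y.X.presheaf.germ U.unop x x.2 s), by
              by_cases hU : Nonempty U.unop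
              · exact ⟨Y.X.germToFunctionField U.unop s, fun x ↦
                  Scheme.algebraMap_germ_eq_germToFunctionField Y.X x.2 s⟩
              · exact ⟨0, fun x ↦ (hU ⟨x⟩).elim⟩⟩
          map_zero' := Subtype.ext (funext fun x ↦
            map_zero ((algebraMap (Y.X.presheaf.stalk x.1) Y.functionField).comp
              (Y.X.presheaf.germ U.unop x x.2).hom))
          map_add' s t := Subtype.ext (funext fun x ↦
            map_add ((algebraMap (Y.X.presheaf.stalk x.1) Y.functionField).comp
              (Y.X.presheaf.germ U.unop x x.2).hom) s t) }
      naturality U V i := by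
        refine AddCommGrpCat.hom_ext (AddMonoidHom.ext fun (s : Γ(Y.X, U.unop)) ↦
          Subtype.ext (funext fun x ↦ ?_))
        change algebraMap _ _ (Y.X.presheaf.germ V.unop x.1 x.2 (Y.X.presheaf.map i s)) =
          algebraMap _ _ (Y.X.presheaf.germ U.unop x.1 (i.unop.le x.2) s)
        congr 1
        exact TopCat.Presheaf.germ_res_apply _ i.unop _ _ _ }

/-- The principal parts of a rational function. -/
noncomputable def toPrincipalPartSheaf : Y.functionSheaf ⟶ Y.principalPartSheaf where
  hom :=
    { app U := AddCommGrpCat.ofHom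
        { toFun f := ⟨fun x q ↦ ((f.1 x : completion q.1) : PrincipalPart q.1), fun x ↦
            ⟨U.unop, x.2, 𝟙 _, f.1 x, fun y q ↦ by
              obtain ⟨c, hc⟩ := f.2
              exact congrArg (fun z : Y.functionField ↦ ((z : completion q.1) : PrincipalPart q.1))
                ((hc y).trans (hc x).symm)⟩⟩
          map_zero' := Subtype.ext (funext fun x ↦ funext fun q ↦
            congrArg QuotientAddGroup.mk
              (IsDedekindDomain.HeightOneSpectrum.adicCompletion.coe_zero _ (place q.1)))
          map_add' f g := Subtype.ext (funext fun x ↦ funext fun q ↦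
            congrArg QuotientAddGroup.mk (coe_add_completion q.1 (f.1 x) (g.1 x))) }
      naturality U V i := rfl }

theorem mk_coe_eq_zero_iff {q : Y.ClosedPoint} (x : completion q) :
    (x : PrincipalPart q) = 0 ↔ x ∈ completionIntegers q :=
  QuotientAddGroup.eq_zero_iff x

/-- The complex of sheaves `𝒪 → K → K/𝒪`. -/
noncomputable def principalPartComplex :
    ShortComplex (CategoryTheory.Sheaf (Opens.grothendieckTopology Y.X) AddCommGrpCat.{u}) :=
  ShortComplex.mk Y.toFunctionSheaf Y.toPrincipalPartSheaf <| by
    refine Sheaf.hom_ext (NatTrans.ext (funext fun U ↦ AddCommGrpCat.hom_ext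
      (AddMonoidHom.ext fun (s : Γ(Y.X, U.unop)) ↦
        Subtype.ext (funext fun x ↦ funext fun q ↦ ?_))))
    refine (Y.mk_coe_eq_zero_iff _).mpr ((coe_mem_completionIntegers_iff q.1 _).mpr ?_)
    have h (y : Y.X) (hy : q.1.point = y) (a : Y.X.presheaf.stalk y) :
        algebraMap _ Y.functionField a ∈ Set.range (algebraMap (localRing q.1) _) := by
      subst hy
      exact ⟨a, rfl⟩
    exact h x.1 q.2 _

/-- Exactness in the middle says that a function regular at all closed points of `U` is a section
over `U`. Local surjectivity is built into the definition of the sheaf of principal parts. -/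
theorem shortExact_principalPartComplex : Y.principalPartComplex.ShortExact := by
  refine TopCat.Sheaf.shortExact_of_sections (X := Y.X) ?_ ?_ ?_
  · intro U
    refine (injective_iff_map_eq_zero _).mpr fun (s : Γ(Y.X, U)) hs ↦ ?_
    by_cases hU : Nonempty U
    · obtain ⟨x⟩ := id hU
      have h0 : algebraMap (Y.X.presheaf.stalk x.1) Y.functionField
          (Y.X.presheaf.germ U x.1 x.2 s) = 0 :=
        congrFun (congrArg Subtype.val hs) x
      rw [Scheme.algebraMap_germ_eq_germToFunctionField] at h0
      exact (injective_iff_map_eq_zero _).mp (Y.X.germToFunctionField_injective U) s h0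
    · have : U = ⊥ := by
        ext x
        exact ⟨fun hx ↦ (hU ⟨x, hx⟩).elim, fun hx ↦ hx.elim⟩
      subst this
      have : Subsingleton Γ(Y.X, ⊥) := inferInstance
      exact @Subsingleton.elim Γ(Y.X, ⊥) this s 0
  · rintro U ⟨f, c, hc⟩ hf
    by_cases hU : Nonempty U
    · have hc' (q : Y.ClosedPoint) (hq : q.point ∈ U) :
          (c : completion q) ∈ completionIntegers q := by
        rw [← mk_coe_eq_zero_iff, ← hc ⟨q.point, hq⟩]
        exact congrFun (congrFun (congrArg Subtype.val hf) ⟨q.point, hq⟩) ⟨q, rfl⟩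
      obtain ⟨s, hs⟩ := exists_germToFunctionField_eq c hc'
      refine ⟨s, Subtype.ext (funext fun x ↦ ?_)⟩
      change algebraMap (Y.X.presheaf.stalk x.1) Y.functionField
          (Y.X.presheaf.germ U x.1 x.2 s) = f x
      rw [Scheme.algebraMap_germ_eq_germToFunctionField, hs, hc]
    · exact ⟨0, Subtype.ext (funext fun x ↦ (hU ⟨x⟩).elim)⟩
  · refine (TopCat.Presheaf.isLocallySurjective_iff _).mpr ?_
    rintro U ⟨s, hs⟩ x hx
    obtain ⟨V, hxV, i, f, hf⟩ := hs ⟨x, hx⟩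
    refine ⟨V, i.le, ⟨⟨fun _ ↦ f, f, fun _ ↦ rfl⟩, ?_⟩, hxV⟩
    exact Subtype.ext (funext fun y ↦ funext fun q ↦ (hf y q).symm)

end SmoothProjCurve

/-! ### The first cohomology group as a quotient of the adeles -/

namespace SmoothProjCurve

variable {k : Type u} [Field k] (Y : SmoothProjCurve k)

/-- The ring of integral adeles, as a subgroup of the adeles. -/
def integralAdeles : AddSubgroup Y.Adele where
  carrier := {a | ∀ q, a q ∈ completionIntegers q}
  zero_mem' q := zero_mem (completionIntegers q)
  add_mem' ha hb q := add_mem (ha q) (hb q)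
  neg_mem' ha q := neg_mem (ha q)

variable {Y} in
theorem eventually_mem_integers (a : Y.Adele) :
    ∀ᶠ q in Filter.cofinite, a q ∈ completionIntegers q := a.2

variable {Y} in
theorem mk_eq_mk_iff {q : Y.ClosedPoint} (x y : completion q) :
    (x : PrincipalPart q) = (y : PrincipalPart q) ↔ x - y ∈ completionIntegers q := by
  rw [← mk_coe_eq_zero_iff, QuotientAddGroup.mk_sub, sub_eq_zero]

theorem exists_isOpen_of_finite (s : Set Y.ClosedPoint) (hs : s.Finite) :
    ∃ U : Y.X.Opens, ∀ x, x ∈ U ↔ ∀ q ∈ s, q.point ≠ x := by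
  have h : IsClosed (⋃ q ∈ s, {q.point} : Set Y.X) :=
    hs.isClosed_biUnion fun q _ ↦ q.isClosed
  refine ⟨⟨_, h.isOpen_compl⟩, fun x ↦ ?_⟩
  change ¬ (x ∈ (⋃ q ∈ s, {q.point} : Set Y.X)) ↔ _
  simp only [Set.mem_iUnion, Set.mem_singleton_iff, exists_prop, not_exists, not_and, eq_comm,
    ne_eq]

/-- A family of local elements, all but finitely many of them integral, differs from a rational
function by integral elements near every point. -/
theorem exists_open_forall_sub_mem (a : ∀ q : Y.ClosedPoint, completion q)
    (ha : ∀ᶠ q in Filter.cofinite, a q ∈ completionIntegers q) (x : Y.X) :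
    ∃ (V : Y.X.Opens) (_ : x ∈ V) (f : Y.functionField), ∀ q : Y.ClosedPoint, q.point ∈ V →
      a q - (f : completion q) ∈ completionIntegers q := by
  obtain ⟨f, hf⟩ : ∃ f : Y.functionField, ∀ q : Y.ClosedPoint, q.point = x →
      a q - (f : completion q) ∈ completionIntegers q := by
    by_cases hx : ∃ q : Y.ClosedPoint, q.point = x
    · obtain ⟨q, rfl⟩ := hx
      obtain ⟨f, hf⟩ := (place q).exists_sub_coe_mem_adicCompletionIntegers (a q)
      refine ⟨f, fun p hp ↦ ?_⟩
      rwa [ClosedPoint.ext hp]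
    · exact ⟨0, fun q hq ↦ (hx ⟨q, hq⟩).elim⟩
  -- Only finitely many closed points violate integrality of `a - f`. Removing them leaves an open
  -- set that still contains `x`, by the choice of `f`.
  have hfin : ∀ᶠ q : Y.ClosedPoint in Filter.cofinite,
      a q - (f : completion q) ∈ completionIntegers q := by
    filter_upwards [ha, Y.eventually_mem_completionIntegers f] with q hq hq'
    exact sub_mem hq hq'
  obtain ⟨V, hV⟩ := Y.exists_isOpen_of_finite _ hfin
  exact ⟨V, (hV x).mpr fun q hq hqx ↦ hq (hf q hqx), f, fun p hp ↦
    not_not.mp fun h ↦ (hV p.point).mp hp p h rfl⟩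

/-- The principal parts of an adele. -/
noncomputable def adelePrincipalParts :
    Y.Adele →+ Y.principalPartSheaf.obj.obj (Opposite.op ⊤) where
  toFun a := ⟨fun x q ↦ (a q.1 : PrincipalPart q.1), fun x ↦ by
    obtain ⟨V, hxV, f, hf⟩ := Y.exists_open_forall_sub_mem a (eventually_mem_integers a) x
    exact ⟨V, hxV, homOfLE le_top, f, fun y q ↦ (Y.mk_eq_mk_iff _ _).mpr
      (hf q.1 (by rw [q.2]; exact y.2))⟩⟩
  map_zero' := rfl
  map_add' _ _ := rfl

theorem adelePrincipalParts_eq_zero_iff (a : Y.Adele) :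
    Y.adelePrincipalParts a = 0 ↔ a ∈ Y.integralAdeles := by
  refine ⟨fun h q ↦ ?_, fun h ↦ Subtype.ext (funext fun x ↦ funext fun q ↦
    (Y.mk_coe_eq_zero_iff _).mpr (h q.1))⟩
  exact (Y.mk_coe_eq_zero_iff _).mp
    (congrFun (congrFun (congrArg Subtype.val h) ⟨q.point, trivial⟩) ⟨q, rfl⟩)

/-- By quasi-compactness finitely many rational functions describe the section everywhere. They have
finitely many poles, so any choice of lifts to the `K_q` is an adele. -/
theorem adelePrincipalParts_surjective : Function.Surjective Y.adelePrincipalParts := by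
  rintro ⟨s, hs⟩
  have : CompactSpace Y.X := QuasiCompact.compactSpace_of_compactSpace Y.hom
  let a (q : Y.ClosedPoint) : completion q := (s ⟨q.point, trivial⟩ ⟨q, rfl⟩).out
  have haq (q : Y.ClosedPoint) : (a q : PrincipalPart q) = s ⟨q.point, trivial⟩ ⟨q, rfl⟩ :=
    Quotient.out_eq _
  choose V hxV i f hf using fun x : Y.X ↦ hs ⟨x, trivial⟩
  obtain ⟨t, ht⟩ := isCompact_univ.elim_nhds_subcover (fun x ↦ (V x : Set Y.X))
    fun x _ ↦ (V x).isOpen.mem_nhds (hxV x)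
  have ha : ∀ᶠ q in Filter.cofinite, a q ∈ completionIntegers q := by
    filter_upwards [(Filter.eventually_all_finset t).mpr
      fun x _ ↦ Y.eventually_mem_completionIntegers (f x)] with q hq
    obtain ⟨x, hxt, hqx⟩ := Set.mem_iUnion₂.mp (ht.2 (Set.mem_univ q.point))
    have h1 := (haq q).trans (hf x ⟨q.point, hqx⟩ ⟨q, rfl⟩)
    have h2 := add_mem ((Y.mk_eq_mk_iff _ _).mp h1) (hq x hxt)
    rwa [sub_add_cancel] at h2
  refine ⟨⟨a, ha⟩, Subtype.ext (funext fun x ↦ funext fun q ↦ ?_)⟩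
  obtain ⟨x, hx⟩ := x
  have h (y : Y.X) (hy : y ∈ (⊤ : Y.X.Opens)) (q : {q : Y.ClosedPoint // q.point = y}) :
      (a q.1 : PrincipalPart q.1) = s ⟨y, hy⟩ q := by
    obtain ⟨q, rfl⟩ := q
    exact haq q
  exact h x hx q

/-- The first cohomology group of the structure sheaf in terms of adeles. -/
theorem exists_adele_to_H1 : ∃ φ : Y.Adele →+ Y.H1, Function.Surjective φ ∧
    φ.ker = Y.principalAdeles ⊔ Y.integralAdeles := by
  have hS := Y.shortExact_principalPartComplex
  let δ : Y.principalPartSheaf.obj.obj (Opposite.op ⊤) →+ Y.H1 := hS.globalSectionsδ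
  refine ⟨δ.comp Y.adelePrincipalParts,
    (hS.globalSectionsδ_surjective
      (TopCat.Sheaf.IsFlasque.subsingleton_H_one (X := Y.X) _ Y.isFlasque_functionSheaf)).comp
      Y.adelePrincipalParts_surjective, ?_⟩
  ext a
  rw [AddMonoidHom.mem_ker, AddSubgroup.mem_sup]
  refine (hS.globalSectionsδ_eq_zero_iff _).trans ⟨?_, ?_⟩
  · rintro ⟨⟨f, c, hc⟩, ht⟩
    refine ⟨Y.diagonal c, ⟨c, rfl⟩, a - Y.diagonal c, fun q ↦ ?_, add_sub_cancel _ _⟩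
    refine (Y.mk_eq_mk_iff _ _).mp ?_
    have h1 : ((f ⟨q.point, trivial⟩ : completion q) : PrincipalPart q) = (a q : PrincipalPart q) :=
      congrFun (congrFun (congrArg Subtype.val ht) ⟨q.point, trivial⟩) ⟨q, rfl⟩
    rw [hc] at h1
    exact h1.symm
  · rintro ⟨_, ⟨c, rfl⟩, b, hb, rfl⟩
    refine ⟨⟨fun _ ↦ c, c, fun _ ↦ rfl⟩, ?_⟩
    rw [map_add, (Y.adelePrincipalParts_eq_zero_iff b).mpr hb, add_zero]
    rfl

theorem natCard_H1 : Nat.card Y.H1 = (Y.principalAdeles ⊔ Y.integralAdeles).index := by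
  obtain ⟨φ, hφ, hker⟩ := Y.exists_adele_to_H1
  rw [← hker, AddSubgroup.index_ker, AddMonoidHom.range_eq_top.mpr hφ]
  exact Nat.card_congr AddSubgroup.topEquiv.toEquiv.symm

end SmoothProjCurve

/-! ### Global functions are constant -/

section

open TensorProduct

/-- A finite separable field extension `L` of `k` with `L ⊗ L` irreducible is trivial. -/
theorem Algebra.bijective_algebraMap_of_irreducibleSpace_tensorProduct (k L : Type*) [Field k]
    [Field L] [Algebra k L] [Module.Finite k L] [Algebra.IsSeparable k L]
    (h : IrreducibleSpace (PrimeSpectrum (L ⊗[k] L))) : Function.Bijective (algebraMap k L) := by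
  -- Separability makes `L ⊗ L` reduced, so it is a domain by irreducibility, and a field because it
  -- is integral over `L`. Multiplication `L ⊗ L → L` is then bijective, and `[L : k]² = [L : k]`.
  have : Algebra.FormallyUnramified k L := (Algebra.FormallyUnramified.iff_isSeparable k L).mpr ‹_›
  have hred : IsReduced (L ⊗[k] L) := Algebra.FormallyUnramified.isReduced_of_field L (L ⊗[k] L)
  have hdom : IsDomain (L ⊗[k] L) := by
    have hp : (nilradical _).IsPrime := PrimeSpectrum.irreducibleSpace_iff_isPrime_nilradical.mp h
    rw [nilradical_eq_zero] at hp
    exact IsDomain.of_bot_isPrime _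
  have hfield : IsField (L ⊗[k] L) :=
    isField_of_isIntegral_of_isField' (R := L) (Field.toIsField L)
  let := hfield.toField
  have hb : Function.Bijective (Algebra.TensorProduct.lmul' k (S := L)) :=
    ⟨(Algebra.TensorProduct.lmul' k (S := L)).toRingHom.injective,
      fun x ↦ ⟨x ⊗ₜ 1, by simp⟩⟩
  have h1 : Module.finrank k (L ⊗[k] L) = Module.finrank k L :=
    (AlgEquiv.ofBijective _ hb).toLinearEquiv.finrank_eq
  rw [Module.finrank_tensorProduct] at h1
  have h2 : Module.finrank k L = 1 := by
    have := Module.finrank_pos (R := k) (M := L)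
    exact Nat.eq_of_mul_eq_mul_left this (by rw [h1, mul_one])
  exact Algebra.bijective_algebraMap_iff.mpr (Subalgebra.bot_eq_top_iff_finrank_eq_one.mpr h2).symm

end

namespace SmoothProjCurve

open Limits

variable {k : Type u} [Field k] (Y : SmoothProjCurve k)

/-- The ring `L = Γ(Y, 𝒪)` is a finite field extension of `k`, separable as `k` is perfect. The
surjection `Y → Spec L` gives by base change a surjection from the irreducible scheme `Y ×ₖ Spec L`
onto `Spec (L ⊗ L)`. -/
theorem bijective_constants [PerfectField k] : Function.Bijective (Y.constants ⊤) := by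
  let F := (Scheme.ΓSpecIso (.of k)).inv ≫ Y.hom.appTop
  have hF : Y.constants ⊤ = F.hom := by
    ext a
    change Y.X.presheaf.map (𝟙 _) _ = _
    rw [Y.X.presheaf.map_id]
    rfl
  rw [hF]
  let := (isField_of_universallyClosed k Y.hom).toField
  algebraize [F.hom]
  have hfin : F.hom.Finite := (finite_appTop_of_universallyClosed k Y.hom).comp
    (RingHom.Finite.of_surjective _ (Scheme.ΓSpecIso (.of k)).symm.commRingCatIsoToRingEquiv.surjective)
  have : Module.Finite k Γ(Y.X, ⊤) := hfin
  have hg : Y.X.toSpecΓ ≫ Spec.map F = Y.hom := by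
    rw [Spec.map_comp, ← Category.assoc, ← Scheme.toSpecΓ_naturality, Category.assoc,
      toSpecΓ_SpecMap_ΓSpecIso_inv, Category.comp_id]
  have hirr : IrreducibleSpace ↥(pullback Y.hom (Spec.map F)) :=
    pullback_of_geometrically Y.geometricallyIrreducible.geometrically_irreducibleSpace _ _
  have hsurj : Surjective Y.X.toSpecΓ := by
    refine ⟨fun x ↦ ?_⟩
    obtain ⟨y⟩ : Nonempty Y.X := inferInstance
    exact ⟨y, Subsingleton.elim (α := PrimeSpectrum Γ(Y.X, ⊤)) _ _⟩
  rw [← hg] at hirr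
  have e := pullbackRightPullbackFstIso (Spec.map F) (Spec.map F) Y.X.toSpecΓ
  let e2 := pullbackSpecIso k Γ(Y.X, ⊤) Γ(Y.X, ⊤)
  let π := e.inv ≫ pullback.snd Y.X.toSpecΓ (pullback.fst (Spec.map F) (Spec.map F)) ≫ e2.hom
  have hπ : Surjective π := inferInstance
  refine Algebra.bijective_algebraMap_of_irreducibleSpace_tensorProduct k Γ(Y.X, ⊤) ?_
  have h := (IrreducibleSpace.isIrreducible_univ _).image π π.continuous.continuousOn
  rw [Set.image_univ, Set.range_eq_univ.mpr π.surjective] at h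
  exact (irreducibleSpace_def _).mpr h

instance : Nontrivial Y.Adele := by
  obtain ⟨q⟩ : Nonempty Y.ClosedPoint := inferInstance
  exact ⟨0, 1, fun h ↦ zero_ne_one (congrArg (fun a : Y.Adele ↦ a q) h)⟩

theorem natCard_inf : Nat.card (Y.principalAdeles ⊓ Y.integralAdeles : AddSubgroup Y.Adele) =
    Nat.card Γ(Y.X, ⊤) := by
  have : Nonempty (⊤ : Y.X.Opens) := ⟨⟨genericPoint Y.X, trivial⟩⟩
  refine (Nat.card_congr (Equiv.ofBijective
    (fun s ↦ ⟨Y.diagonal (Y.X.germToFunctionField ⊤ s), ⟨_, rfl⟩,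
      fun q ↦ coe_germToFunctionField_mem_completionIntegers s q trivial⟩) ⟨?_, ?_⟩)).symm
  · intro s t h
    exact Y.X.germToFunctionField_injective ⊤ (Y.diagonal.injective (congrArg Subtype.val h))
  · rintro ⟨_, ⟨f, rfl⟩, hf⟩
    obtain ⟨s, rfl⟩ := exists_germToFunctionField_eq (U := ⊤) f fun q _ ↦ hf q
    exact ⟨s, rfl⟩

theorem natCard_principalAdeles_inf_integralAdeles [PerfectField k] :
    Nat.card (Y.principalAdeles ⊓ Y.integralAdeles : AddSubgroup Y.Adele) = Nat.card k :=
  Y.natCard_inf.trans (Nat.card_congr (Equiv.ofBijective _ Y.bijective_constants)).symm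

end SmoothProjCurve

/-! ### Strong approximation and valuations in Dedekind domains -/

namespace IsDedekindDomain

open HeightOneSpectrum

variable {B K : Type*} [CommRing B] [IsDedekindDomain B] [Field K] [Algebra B K]
  [IsFractionRing B K]

/-- Strong approximation: finitely many principal parts are the principal parts of an element of
the fraction field that is integral elsewhere. -/
theorem exists_forall_valuation_sub_le_one (F : HeightOneSpectrum B → K)
    (T : Finset (HeightOneSpectrum B)) :
    ∃ f : K, (∀ p ∈ T, p.valuation K (F p - f) ≤ 1) ∧ ∀ p ∉ T, p.valuation K f ≤ 1 := by
  classical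
  obtain ⟨s, hs⟩ := IsLocalization.exist_integer_multiples (nonZeroDivisors B) T F
  have hs0 : (s : B) ≠ 0 := nonZeroDivisors.ne_zero s.2
  have hsK : algebraMap B K s ≠ 0 := by simp [hs0]
  choose! b hb using hs
  have hb' (p) (hp : p ∈ T) : F p = algebraMap B K (b p) / algebraMap B K s := by
    rw [hb p hp, eq_div_iff hsK, mul_comm, Algebra.smul_def]
  -- The primes dividing the common denominator `s` are added. With `e p` the order of `s` at `p`,
  -- the Chinese remainder theorem yields a numerator congruent modulo `p ^ e p` to the given one on
  -- `T` and to zero on the rest of `T'`.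
  let T' := T ∪ (Support.finite B ((algebraMap B K s)⁻¹)).toFinset
  have hT' (p) (hp : p ∉ T') : p.valuation K ((algebraMap B K s)⁻¹) ≤ 1 := by
    by_contra! h
    exact hp (Finset.mem_union_right _ ((Set.Finite.mem_toFinset _).mpr h))
  have he (p : HeightOneSpectrum B) : ∃ n : ℕ, ∀ x ∈ p.asIdeal ^ n,
      p.valuation K (algebraMap B K x / algebraMap B K s) ≤ 1 := by
    obtain ⟨n, hn⟩ : ∃ n : ℕ, p.intValuation s = WithZero.exp (-(n : ℤ)) :=
      ⟨_, p.intValuation_if_neg hs0⟩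
    refine ⟨n, fun x hx ↦ ?_⟩
    have h1 := (p.intValuation_le_pow_iff_mem x n).mpr hx
    rw [← hn] at h1
    rw [map_div₀, valuation_of_algebraMap, valuation_of_algebraMap]
    exact div_le_one_of_le₀ h1 zero_le
  choose e he using he
  obtain ⟨y, hy⟩ := IsDedekindDomain.exists_forall_sub_mem_ideal (s := T')
    (fun p ↦ p.asIdeal) e (fun p _ ↦ p.prime) (fun p _ q _ hpq h ↦ hpq (HeightOneSpectrum.ext h))
    fun p ↦ if p.1 ∈ T then b p.1 else 0
  refine ⟨algebraMap B K y / algebraMap B K s, fun p hp ↦ ?_, fun p hp ↦ ?_⟩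
  · have h := he p _ (hy p (Finset.mem_union_left _ hp))
    rw [if_pos hp, map_sub, sub_div, ← hb' p hp] at h
    rwa [Valuation.map_sub_swap]
  · by_cases hp' : p ∈ T'
    · have h := he p _ (hy p hp')
      rwa [if_neg hp, sub_zero] at h
    · rw [div_eq_mul_inv, map_mul]
      exact mul_le_one' (p.valuation_le_one y) (hT' p hp')

/-- A nontrivial valuation on the fraction field of a Dedekind domain that is at most one on this
domain is equivalent to the valuation of a prime. -/
theorem exists_valuation_le_one_iff {Γ₀ : Type*} [LinearOrderedCommGroupWithZero Γ₀]
    (v : Valuation K Γ₀) (hB : ∀ b : B, v (algebraMap B K b) ≤ 1) (hv : ∃ x, 1 < v x) :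
    ∃ p : HeightOneSpectrum B, ∀ x, p.valuation K x ≤ 1 ↔ v x ≤ 1 := by
  -- The prime is the centre of `v` on `B`. It is nonzero, since otherwise every denominator would
  -- have value one and `v ≤ 1` on `K`.
  let P : Ideal B :=
    { carrier := {b | v (algebraMap B K b) < 1}
      zero_mem' := by simp
      add_mem' := fun {a b} ha hb ↦ by
        rw [Set.mem_ofPred_eq, map_add]
        exact v.map_add_lt ha hb
      smul_mem' := fun a b hb ↦ by
        rw [Set.mem_ofPred_eq, smul_eq_mul, map_mul, map_mul]
        exact mul_lt_one_of_nonneg_of_lt_one_right (hB a) zero_le hb }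
  have hPp : P.IsPrime := by
    refine ⟨fun h ↦ ?_, fun {a b} hab ↦ ?_⟩
    · have h1 : v (algebraMap B K 1) < 1 := (Ideal.eq_top_iff_one P).mp h
      simp at h1
    · by_contra! h
      have h1 : 1 ≤ v (algebraMap B K a) := not_lt.mp h.1
      have h2 : 1 ≤ v (algebraMap B K b) := not_lt.mp h.2
      have h3 : v (algebraMap B K (a * b)) < 1 := hab
      rw [map_mul, map_mul] at h3
      exact (one_le_mul h1 h2).not_gt h3
  have hP0 : P ≠ ⊥ := by
    rintro h
    obtain ⟨x, hx⟩ := hv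
    obtain ⟨a, s, hs, rfl⟩ := IsFractionRing.div_surjective B x
    have hs1 : v (algebraMap B K s) = 1 := by
      refine (hB s).antisymm (not_lt.mp fun hlt ↦ nonZeroDivisors.ne_zero hs ?_)
      exact (Submodule.eq_bot_iff P).mp h s hlt
    rw [map_div₀, hs1, div_one] at hx
    exact hx.not_ge (hB a)
  let p : HeightOneSpectrum B := ⟨P, hPp, hP0⟩
  have hd (d : p.asIdeal.primeCompl) : v (algebraMap B K d) = 1 :=
    (hB d).antisymm (not_lt.mp d.2)
  have h1 (x : K) (hx : p.valuation K x ≤ 1) : v x ≤ 1 := by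
    obtain ⟨a, s, h⟩ := p.exists_primeCompl_mul_eq_of_integer x hx
    have h' := congrArg v h
    rw [map_mul, hd, mul_one] at h'
    exact h'.trans_le (hB a)
  refine ⟨p, fun x ↦ ⟨h1 x, fun hx ↦ ?_⟩⟩
  -- If `x` is not integral at `p`, then its inverse is in the maximal ideal of the local ring at
  -- `p`, on which `v < 1`.
  by_contra! hx'
  have hx0 : p.valuation K x⁻¹ < 1 := by
    rw [map_inv₀]; exact inv_lt_one_of_one_lt₀ hx'
  obtain ⟨a, s, h⟩ := p.exists_primeCompl_mul_eq_of_integer x⁻¹ hx0.le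
  have ha : a ∈ p.asIdeal := by
    refine (p.valuation_lt_one_iff_mem (K := K) a).mp ?_
    change p.valuation K (algebraMap B K a) < 1
    rw [← h, map_mul]
    exact mul_lt_one_of_lt_of_le hx0 (p.valuation_le_one _)
  have h' := congrArg v h
  rw [map_mul, hd, mul_one, map_inv₀] at h'
  have h2 : (v x)⁻¹ < 1 := h'.trans_lt ha
  have hx0 : v x ≠ 0 := by
    rw [Valuation.ne_zero_iff]
    rintro rfl
    simp at hx'
  exact ((one_le_inv₀ (zero_lt_iff.mpr hx0)).mpr hx).not_gt h2

end IsDedekindDomain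

/-! ### Valuations and approximation over k(t) -/

namespace Valuation

open Polynomial IntermediateField

variable {k K : Type*} [Field k] [Field K] [Algebra k K] {Γ₀ : Type*}
  [LinearOrderedCommGroupWithZero Γ₀] (v : Valuation K Γ₀) {t : K}

theorem aeval_le_pow (hk : ∀ c : k, v (algebraMap k K c) ≤ 1) (ht : 1 ≤ v t) (p : k[X]) {n : ℕ}
    (hn : p.natDegree ≤ n) : v (aeval t p) ≤ v t ^ n := by
  rw [aeval_eq_sum_range]
  refine v.map_sum_le fun i hi ↦ ?_
  rw [Algebra.smul_def, map_mul, map_pow]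
  exact (mul_le_of_le_one_left' (hk _)).trans
    (pow_le_pow_right₀ ht ((Finset.mem_range_succ_iff.mp hi).trans hn))

/-- Nonzero constants have value one, so at a pole of `t` the leading term dominates strictly. -/
theorem aeval_eq_pow (hk : ∀ c : k, v (algebraMap k K c) ≤ 1) (ht : 1 < v t) {p : k[X]}
    (hp : p ≠ 0) : v (aeval t p) = v t ^ p.natDegree := by
  have hc (c : k) (hc : c ≠ 0) : v (algebraMap k K c) = 1 := by
    refine (hk c).antisymm ?_
    have h := hk c⁻¹
    rw [map_inv₀, map_inv₀] at h
    exact (inv_le_one₀ (zero_lt_iff.mpr (by simpa using hc))).mp h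
  have hl : v (aeval t (C p.leadingCoeff * X ^ p.natDegree)) = v t ^ p.natDegree := by
    rw [map_mul, aeval_C, map_pow, aeval_X, map_mul, map_pow, hc _ (leadingCoeff_ne_zero.mpr hp),
      one_mul]
  obtain hn | hn := Nat.eq_zero_or_pos p.natDegree
  · rw [eq_C_of_natDegree_eq_zero hn, aeval_C, natDegree_C, pow_zero]
    refine hc _ fun h0 ↦ hp ?_
    rw [eq_C_of_natDegree_eq_zero hn, h0, C_0]
  · conv_lhs => rw [← p.eraseLead_add_C_mul_X_pow]
    rw [map_add, v.map_add_eq_of_lt_right ?_, hl]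
    rw [hl]
    exact (v.aeval_le_pow hk ht.le _ p.eraseLead_natDegree_le).trans_lt
      (pow_lt_pow_right₀ ht (Nat.sub_lt hn one_pos))

/-- An element of `k(t)` is the sum of a polynomial in `t` and an element that is integral at all
poles of `t`. -/
theorem exists_mem_adjoin_sub_le_one (r : k⟮t⟯) : ∃ p ∈ Algebra.adjoin k {t},
    ∀ {Γ₀ : Type*} [LinearOrderedCommGroupWithZero Γ₀] (v : Valuation K Γ₀),
      (∀ c : k, v (algebraMap k K c) ≤ 1) → 1 < v t → v (r - p) ≤ 1 := by
  open scoped IntermediateField.algebraAdjoinAdjoin in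
  obtain ⟨⟨a, ha⟩, ⟨d, hd⟩, hd0, rfl⟩ := IsFractionRing.div_surjective (Algebra.adjoin k {t}) r
  rw [Algebra.adjoin_singleton_eq_range_aeval] at ha hd
  obtain ⟨a, rfl⟩ := ha
  obtain ⟨d, rfl⟩ := hd
  have hd0' : aeval t d ≠ 0 := fun h ↦ nonZeroDivisors.ne_zero hd0 (Subtype.ext h)
  -- The polynomial is the quotient of the Euclidean division of `a` by `d`. The remainder has
  -- smaller degree than `d`, so its ratio to `d` is integral at the poles of `t`.
  refine ⟨aeval t (a / d), aeval_mem_adjoin_singleton _ _, fun v hk ht ↦ ?_⟩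
  have h0 : d ≠ 0 := by rintro rfl; simp at hd0'
  have h1 : aeval t a / aeval t d - aeval t (a / d) = aeval t (a % d) / aeval t d := by
    rw [eq_div_iff hd0', sub_mul, div_mul_cancel₀ _ hd0', sub_eq_iff_eq_add, ← map_mul, ← map_add,
      mul_comm, add_comm, EuclideanDomain.div_add_mod]
  change v (aeval t a / aeval t d - aeval t (a / d)) ≤ 1
  rw [h1, map_div₀, v.aeval_eq_pow hk ht h0]
  exact div_le_one_of_le₀ (v.aeval_le_pow hk ht.le _ (by
    exact natDegree_le_natDegree (degree_mod_lt a h0).le)) zero_le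

end Valuation

namespace Valuation

open IntermediateField
open scoped IntermediateField.algebraAdjoinAdjoin

theorem le_one_of_isIntegral {A K Γ₀ : Type*} [CommRing A] [Field K] [Algebra A K]
    [LinearOrderedCommGroupWithZero Γ₀] (v : Valuation K Γ₀)
    (hA : ∀ a : A, v (algebraMap A K a) ≤ 1) {x : K} (hx : IsIntegral A x) : v x ≤ 1 := by
  let φ : A →+* v.integer := (algebraMap A K).codRestrict v.integer hA
  exact (integer.integers v).mem_of_integral
    (hx.map_of_comp_eq φ (RingHom.id K) (RingHom.ext fun _ ↦ rfl))

variable {k K : Type*} [Field k] [Field K] [Algebra k K] (t : K) {Γ₀ : Type*}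
  [LinearOrderedCommGroupWithZero Γ₀]

theorem le_one_of_mem_adjoin (v : Valuation K Γ₀) (hk : ∀ c : k, v (algebraMap k K c) ≤ 1)
    (ht : v t ≤ 1) {x : K} (hx : x ∈ Algebra.adjoin k {t}) : v x ≤ 1 := by
  induction hx using Algebra.adjoin_induction with
  | mem x hx => rwa [Set.mem_singleton_iff.mp hx]
  | algebraMap c => exact hk c
  | add x y _ _ hx hy => exact v.map_add_le hx hy
  | mul x y _ _ hx hy => rw [map_mul]; exact mul_le_one' hx hy

instance : IsPrincipalIdealRing (Algebra.adjoin k {t}) := by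
  rw [Algebra.adjoin_singleton_eq_range_aeval]
  exact .of_surjective (Polynomial.aeval (R := k) t).rangeRestrict
    (Polynomial.aeval (R := k) t).rangeRestrict_surjective

variable (k) [FiniteDimensional k⟮t⟯ K]

/-- Up to an element that is integral outside the poles of `t`, every element of a finite separable
extension of `k(t)` has poles that are bounded at the poles of `t`. -/
theorem exists_eq_add_sum_mul : ∃ (n : ℕ) (b : Fin n → K), ∀ g : K, ∃ (f : K) (s : Fin n → K),
    g = f + ∑ j, s j * b j ∧ ∀ v : Valuation K Γ₀, (∀ c : k, v (algebraMap k K c) ≤ 1) →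
      (v t ≤ 1 → v f ≤ 1) ∧ (1 < v t → ∀ j, v (s j) ≤ 1) := by
  -- Take a basis over `k(t)` that is integral over `k[t]`. The polynomial parts of the coordinates
  -- of `g` make up `f`; the remaining parts `s j` are integral at the poles of `t`.
  obtain ⟨S, b, hb⟩ := FiniteDimensional.exists_is_basis_integral (Algebra.adjoin k {t}) k⟮t⟯ K
  let e := Fintype.equivFin S
  let b' := b.reindex e
  refine ⟨_, b', fun g ↦ ?_⟩
  choose p hp hps using fun j ↦ exists_mem_adjoin_sub_le_one (k := k) (t := t) (b'.repr g j)
  refine ⟨∑ j, p j * b' j, fun j ↦ b'.repr g j - p j, ?_, fun v hk ↦ ⟨fun ht ↦ ?_,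
    fun ht j ↦ hps j v hk ht⟩⟩
  · conv_lhs => rw [← b'.sum_repr g]
    rw [← Finset.sum_add_distrib]
    refine Finset.sum_congr rfl fun j _ ↦ ?_
    rw [sub_mul, add_sub_cancel]
    rfl
  · refine v.map_sum_le fun j _ ↦ ?_
    rw [map_mul]
    refine mul_le_one' (v.le_one_of_mem_adjoin t hk ht (hp j))
      (v.le_one_of_isIntegral (A := Algebra.adjoin k {t})
        (fun a ↦ v.le_one_of_mem_adjoin t hk ht a.2) ?_)
    rw [b.reindex_apply]
    exact hb _

variable [Algebra.IsSeparable k⟮t⟯ K]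

/-- Strong approximation for finite separable extensions of `k(t)`. -/
theorem exists_forall_sub_le_one {ι : Type*} (v : ι → Valuation K Γ₀)
    (hk : ∀ i (c : k), v i (algebraMap k K c) ≤ 1) (hv : ∀ i, ∃ x, 1 < v i x)
    (hinj : ∀ i j, (∀ x, v i x ≤ 1 ↔ v j x ≤ 1) → i = j) (F : ι → K) (T : Finset ι)
    (hT : ∀ i ∈ T, v i t ≤ 1) :
    ∃ f, (∀ i ∈ T, v i (F i - f) ≤ 1) ∧ ∀ i ∉ T, v i t ≤ 1 → v i f ≤ 1 := by
  classical
  let A := Algebra.adjoin k {t}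
  let B := integralClosure A K
  have : IsDedekindDomain B := integralClosure.isDedekindDomain A k⟮t⟯ K
  have : IsFractionRing B K := integralClosure.isFractionRing_of_finite_extension k⟮t⟯ K
  -- Where `t` is integral so is the whole of `B`, so these valuations come from primes of `B`,
  -- distinct ones by `hinj`. Strong approximation in `B` then applies.
  have h (i : ι) (hi : v i t ≤ 1) : ∃ p : IsDedekindDomain.HeightOneSpectrum B,
      ∀ x, p.valuation K x ≤ 1 ↔ v i x ≤ 1 :=
    IsDedekindDomain.exists_valuation_le_one_iff (v i)
      (fun b ↦ (v i).le_one_of_isIntegral (A := A)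
        (fun a ↦ (v i).le_one_of_mem_adjoin t (hk i) hi a.2) b.2) (hv i)
  obtain hne | hne := isEmpty_or_nonempty (IsDedekindDomain.HeightOneSpectrum B)
  · exact ⟨0, fun i hi ↦ hne.elim (h i (hT i hi)).choose, fun i _ hi ↦ hne.elim (h i hi).choose⟩
  choose! p hp using h
  have hpinj (i j) (hi : v i t ≤ 1) (hj : v j t ≤ 1) (hij : p i = p j) : i = j :=
    hinj i j fun x ↦ by rw [← hp i hi, hij, hp j hj]
  obtain ⟨f, hf, hf'⟩ := IsDedekindDomain.exists_forall_valuation_sub_le_one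
    (fun P ↦ if h : ∃ i ∈ T, p i = P then F h.choose else 0) (T.image p)
  refine ⟨f, fun i hi ↦ ?_, fun i hi hit ↦ (hp i hit f).mp (hf' _ fun h ↦ ?_)⟩
  · have hex : ∃ j ∈ T, p j = p i := ⟨i, hi, rfl⟩
    have h := hf (p i) (Finset.mem_image_of_mem p hi)
    rw [dif_pos hex, hpinj _ i (hT _ hex.choose_spec.1) (hT i hi) hex.choose_spec.2] at h
    exact (hp i (hT i hi) _).mp h
  · obtain ⟨j, hj, hji⟩ := Finset.mem_image.mp h
    exact hi (hpinj j i (hT j hj) hit hji ▸ hj)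

end Valuation

/-! ### A separating element of the function field -/

namespace SmoothProjCurve

open IntermediateField

variable {k : Type u} [Field k] (Y : SmoothProjCurve k)

noncomputable instance (U : Y.X.Opens) : Algebra k Γ(Y.X, U) := (Y.constants U).toAlgebra

noncomputable instance : Algebra k Y.functionField :=
  haveI : Nonempty (⊤ : Y.X.Opens) := ⟨⟨genericPoint Y.X, trivial⟩⟩
  ((Y.X.germToFunctionField ⊤).hom.comp (Y.constants ⊤)).toAlgebra

instance (U : Y.X.Opens) [Nonempty U] : IsScalarTower k Γ(Y.X, U) Y.functionField :=
  .of_algebraMap_eq fun a ↦ by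
    change _ = Y.X.germToFunctionField U (Y.constants U a)
    rw [← Y.map_constants (homOfLE le_top : U ⟶ ⊤).op a]
    exact (TopCat.Presheaf.germ_res_apply Y.X.presheaf _ _ _ _).symm

theorem coe_algebraMap_mem_completionIntegers (c : k) (q : Y.ClosedPoint) :
    ((algebraMap k Y.functionField c : Y.functionField) : completion q) ∈ completionIntegers q :=
  haveI : Nonempty (⊤ : Y.X.Opens) := ⟨⟨genericPoint Y.X, trivial⟩⟩
  coe_germToFunctionField_mem_completionIntegers _ q trivial

/-- Near any point the smooth curve is étale over the affine line; `t` is the pulled-back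
coordinate. Then `K` is formally unramified and essentially of finite type over the field `k(t)`,
hence finite separable. -/
theorem exists_finiteDimensional_isSeparable : ∃ t : Y.functionField,
    FiniteDimensional k⟮t⟯ Y.functionField ∧ Algebra.IsSeparable k⟮t⟯ Y.functionField := by
  obtain ⟨y⟩ : Nonempty Y.X := inferInstance
  obtain ⟨U, hU, V, hV, hyV, e, h⟩ :=
    SmoothOfRelativeDimension.exists_isStandardSmoothOfRelativeDimension (n := 1) (f := Y.hom) y
  have : Nonempty V := ⟨⟨y, hyV⟩⟩
  have := functionField_isFractionRing_of_isAffineOpen Y.X V hV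
  have hUtop : U = ⊤ := by
    ext x
    have : x = Y.hom y := Subsingleton.elim (α := PrimeSpectrum k) _ _
    simp only [this, SetLike.mem_coe, TopologicalSpace.Opens.coe_top, Set.mem_univ, iff_true]
    exact e hyV
  subst hUtop
  obtain ⟨g, hgC, hg⟩ := h.exists_etale_mvPolynomial
  let P := MvPolynomial (Fin 1) Γ(Spec (.of k), ⊤)
  let K := Y.functionField
  let t : K := algebraMap Γ(Y.X, V) K (g (MvPolynomial.X 0))
  let : Algebra P Γ(Y.X, V) := g.toAlgebra
  have : Algebra.Etale P Γ(Y.X, V) := hg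
  let : Algebra P K := ((algebraMap Γ(Y.X, V) K).comp g).toAlgebra
  have : IsScalarTower P Γ(Y.X, V) K := .of_algebraMap_eq fun _ ↦ rfl
  have hk (a : Γ(Spec (.of k), ⊤)) : g (MvPolynomial.C a) =
      algebraMap k Γ(Y.X, V) ((Scheme.ΓSpecIso (.of k)).hom a) := by
    change (g.comp MvPolynomial.C) a = Y.X.presheaf.map (homOfLE le_top : V ⟶ ⊤).op
      (Y.hom.appTop ((Scheme.ΓSpecIso (.of k)).inv ((Scheme.ΓSpecIso (.of k)).hom a)))
    rw [hgC, Iso.hom_inv_id_apply]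
    rfl
  have hPt (x : P) : algebraMap P K x ∈ k⟮t⟯ := by
    induction x using MvPolynomial.induction_on with
    | C a =>
      change algebraMap Γ(Y.X, V) K (g (MvPolynomial.C a)) ∈ k⟮t⟯
      rw [hk, ← IsScalarTower.algebraMap_apply]
      exact k⟮t⟯.algebraMap_mem _
    | add x y hx hy => rw [map_add]; exact add_mem hx hy
    | mul_X x i hx =>
      rw [map_mul, Subsingleton.elim i 0]
      exact mul_mem hx (mem_adjoin_simple_self k t)
  let : Algebra P k⟮t⟯ := ((algebraMap P K).codRestrict k⟮t⟯ hPt).toAlgebra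
  have : IsScalarTower P k⟮t⟯ K := .of_algebraMap_eq fun _ ↦ rfl
  have : Algebra.FormallyUnramified Γ(Y.X, V) K :=
    .of_isLocalization (nonZeroDivisors Γ(Y.X, V))
  have : Algebra.FormallyUnramified P K := .comp P Γ(Y.X, V) K
  have : Algebra.FormallyUnramified k⟮t⟯ K := .of_restrictScalars P k⟮t⟯ K
  have : Algebra.EssFiniteType Γ(Y.X, V) K := .of_isLocalization _ (nonZeroDivisors Γ(Y.X, V))
  have : Algebra.EssFiniteType P K := .comp P Γ(Y.X, V) K
  have : Algebra.EssFiniteType k⟮t⟯ K := .of_comp P k⟮t⟯ K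
  exact ⟨t, Algebra.FormallyUnramified.finite_of_free k⟮t⟯ K,
    Algebra.FormallyUnramified.isSeparable k⟮t⟯ K⟩

end SmoothProjCurve

theorem AddSubgroup.finiteIndex_of_isCompact {G : Type*} [AddCommGroup G] [TopologicalSpace G]
    [IsTopologicalAddGroup G] (H : AddSubgroup G) (hH : IsOpen (H : Set G)) {C : Set G}
    (hC : IsCompact C) (h : ∀ g, ∃ c ∈ C, g - c ∈ H) : H.FiniteIndex := by
  have : DiscreteTopology (G ⧸ H) := QuotientAddGroup.discreteTopology hH
  have hsurj : (QuotientAddGroup.mk '' C : Set (G ⧸ H)) = Set.univ := by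
    refine Set.eq_univ_of_forall fun x ↦ ?_
    obtain ⟨g, rfl⟩ := QuotientAddGroup.mk_surjective x
    obtain ⟨c, hc, hgc⟩ := h g
    refine ⟨c, hc, QuotientAddGroup.eq.mpr ?_⟩
    rwa [neg_add_eq_sub]
  have hcomp := hC.image (QuotientAddGroup.continuous_mk (N := H))
  rw [hsurj] at hcomp
  have : CompactSpace (G ⧸ H) := ⟨hcomp⟩
  have : Finite (G ⧸ H) := finite_of_compact_of_discrete
  exact H.finiteIndex_of_finite_quotient

/-! ### Bounded poles and finiteness of the index -/

namespace SmoothProjCurve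

open IntermediateField

variable {k : Type u} [Field k] {Y : SmoothProjCurve k}

theorem valuation_le_one_iff (q : Y.ClosedPoint) (f : Y.functionField) :
    (place q).valuation Y.functionField f ≤ 1 ↔ (f : completion q) ∈ completionIntegers q := by
  rw [IsDedekindDomain.HeightOneSpectrum.mem_adicCompletionIntegers,
    IsDedekindDomain.HeightOneSpectrum.adicCompletion.valued_coe]

theorem exists_one_lt_valuation (q : Y.ClosedPoint) :
    ∃ f, 1 < (place q).valuation Y.functionField f := by
  obtain ⟨π, hπ⟩ := (place q).valuation_exists_uniformizer Y.functionField
  refine ⟨π⁻¹, ?_⟩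
  rw [map_inv₀, hπ, ← WithZero.exp_neg, neg_neg, ← WithZero.exp_zero, WithZero.exp_lt_exp]
  exact one_pos

theorem eq_of_valuation_le_one_iff (p q : Y.ClosedPoint)
    (h : ∀ f, (place p).valuation Y.functionField f ≤ 1 ↔
      (place q).valuation Y.functionField f ≤ 1) : p = q := by
  refine eq_of_range_algebraMap_eq p q (SetLike.ext fun f ↦ ?_)
  have := h f
  rw [valuation_le_one_iff, valuation_le_one_iff, coe_mem_completionIntegers_iff,
    coe_mem_completionIntegers_iff] at this
  exact this

theorem valuation_algebraMap_le_one (q : Y.ClosedPoint) (c : k) :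
    (place q).valuation Y.functionField (algebraMap k Y.functionField c) ≤ 1 :=
  (valuation_le_one_iff q _).mpr (Y.coe_algebraMap_mem_completionIntegers c q)

/-- Strong approximation away from the poles of a rational function. -/
theorem exists_forall_sub_mem_of_valuation_le_one (t : Y.functionField)
    [FiniteDimensional k⟮t⟯ Y.functionField] [Algebra.IsSeparable k⟮t⟯ Y.functionField]
    (a : Y.Adele) : ∃ f : Y.functionField, ∀ q : Y.ClosedPoint,
      (place q).valuation Y.functionField t ≤ 1 →
        a q - (f : completion q) ∈ completionIntegers q := by
  classical
  -- Density replaces each component of `a` by an element of `K`. Only the finitely many places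
  -- where `a` is not integral and `t` is integral need matching.
  choose F hF using fun q ↦ (place q).exists_sub_coe_mem_adicCompletionIntegers (a q)
  have hfin : {q | a q ∉ completionIntegers q}.Finite := eventually_mem_integers a
  obtain ⟨f, hf, hf'⟩ := Valuation.exists_forall_sub_le_one k t
    (fun q : Y.ClosedPoint ↦ (place q).valuation Y.functionField)
    valuation_algebraMap_le_one exists_one_lt_valuation eq_of_valuation_le_one_iff F
    (hfin.toFinset.filter fun q ↦ (place q).valuation Y.functionField t ≤ 1)
    (fun q hq ↦ (Finset.mem_filter.mp hq).2)
  refine ⟨f, fun q hq ↦ ?_⟩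
  by_cases haq : a q ∈ completionIntegers q
  · have := hf' q (fun h ↦ (Set.Finite.mem_toFinset _).mp (Finset.mem_filter.mp h).1 haq) hq
    exact sub_mem haq ((valuation_le_one_iff q f).mp this)
  · have := hf q (Finset.mem_filter.mpr ⟨(Set.Finite.mem_toFinset _).mpr haq, hq⟩)
    rw [valuation_le_one_iff, coe_sub_completion] at this
    simpa only [sub_add_sub_cancel] using add_mem (hF q) this

variable (Y)

theorem isOpen_integralAdeles : IsOpen (Y.integralAdeles : Set Y.Adele) :=
  RestrictedProduct.isOpen_forall_mem (A := fun q ↦ (completionIntegers q : Set (completion q)))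
    isOpen_completionIntegers

theorem isCompact_integralAdeles [Finite k] : IsCompact (Y.integralAdeles : Set Y.Adele) :=
  RestrictedProduct.isCompact_setOf_forall_mem
    (A := fun q ↦ (completionIntegers q : Set (completion q))) isCompact_completionIntegers

/-- The poles of adeles modulo rational functions are bounded. -/
theorem exists_eq_diagonal_add_mul : ∃ c : Y.Adele, ∀ a : Y.Adele, ∃ (f : Y.functionField),
    ∃ u ∈ Y.integralAdeles, a = Y.diagonal f + c * u := by
  classical
  obtain ⟨t, ht, ht'⟩ := Y.exists_finiteDimensional_isSeparable
  have hinv : k⟮t⁻¹⟯ = k⟮t⟯ := by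
    refine le_antisymm ?_ ?_
    · rw [adjoin_simple_le_iff]
      exact inv_mem (mem_adjoin_simple_self k t)
    · rw [adjoin_simple_le_iff]
      simpa only [inv_inv] using inv_mem (mem_adjoin_simple_self k t⁻¹)
  have hi : FiniteDimensional k⟮t⁻¹⟯ Y.functionField := by rwa [hinv]
  have hi' : Algebra.IsSeparable k⟮t⁻¹⟯ Y.functionField := by rwa [hinv]
  obtain ⟨n, b, hb⟩ := Valuation.exists_eq_add_sum_mul (Γ₀ := WithZero (Multiplicative ℤ)) k t
  let v (q : Y.ClosedPoint) := (place q).valuation Y.functionField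
  -- At a pole of `t` the component `c q` dominates `1` and all `b j`. Elsewhere it is `1`, so `c`
  -- is an adele because `t` has finitely many poles.
  have hc (q : Y.ClosedPoint) : ∃ c : Y.functionField, 1 ≤ v q c ∧ (∀ j, 1 < v q t →
      v q (b j) ≤ v q c) ∧ (v q t ≤ 1 → c = 1) := by
    by_cases hq : v q t ≤ 1
    · exact ⟨1, (map_one _).ge, fun _ h ↦ (h.not_ge hq).elim, fun _ ↦ rfl⟩
    · obtain ⟨c, -, hc⟩ := (insert 1 (Finset.univ.image b)).exists_max_image (v q)
        ⟨1, Finset.mem_insert_self _ _⟩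
      refine ⟨c, ?_, fun j _ ↦ hc _ (Finset.mem_insert_of_mem (Finset.mem_image_of_mem b
        (Finset.mem_univ j))), fun h ↦ (hq h).elim⟩
      simpa using hc 1 (Finset.mem_insert_self _ _)
  choose c hc1 hcb hct using hc
  have hc0 (q) : (c q : completion q) ≠ 0 := by
    intro h
    have := hc1 q
    rw [← IsDedekindDomain.HeightOneSpectrum.adicCompletion.valued_coe, h, map_zero] at this
    exact this.not_gt zero_lt_one
  refine ⟨⟨fun q ↦ c q, ?_⟩, fun a ↦ ?_⟩
  · filter_upwards [Y.eventually_mem_completionIntegers t] with q hq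
    rw [hct q ((valuation_le_one_iff q t).mpr hq),
      IsDedekindDomain.HeightOneSpectrum.adicCompletion.coe_one]
    exact one_mem (completionIntegers q)
  -- The function `f` corrects `a` where `t` is integral, and `g` corrects the rest at the poles of
  -- `t`. As `g` may spoil the other places, only its part `h` that is integral there is used; the
  -- error `∑ s j * b j` at the poles of `t` is bounded by `c`.
  obtain ⟨f, hf⟩ := exists_forall_sub_mem_of_valuation_le_one t a
  obtain ⟨g, hg⟩ := exists_forall_sub_mem_of_valuation_le_one t⁻¹ (a - Y.diagonal f)
  obtain ⟨h, s, hgs, hs⟩ := hb g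
  have key (q : Y.ClosedPoint) :
      (a q - ((f + h : Y.functionField) : completion q)) / (c q : completion q) ∈
        completionIntegers q := by
    rw [IsDedekindDomain.HeightOneSpectrum.mem_adicCompletionIntegers, map_div₀]
    refine div_le_one_of_le₀ ?_ zero_le
    rw [IsDedekindDomain.HeightOneSpectrum.adicCompletion.valued_coe]
    have hsq := hs (v q) (valuation_algebraMap_le_one q)
    by_cases hq : v q t ≤ 1
    · have h1 : a q - ((f + h : Y.functionField) : completion q) ∈ completionIntegers q := by
        rw [coe_add_completion, ← sub_sub]
        exact sub_mem (hf q hq) ((valuation_le_one_iff q h).mp (hsq.1 hq))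
      exact h1.trans (hc1 q)
    · have h1 : a q - (f : completion q) - (g : completion q) ∈ completionIntegers q := by
        refine hg q ?_
        rw [map_inv₀]
        exact inv_le_one_of_one_le₀ (not_le.mp hq).le
      have h2 : a q - ((f + h : Y.functionField) : completion q) =
          (a q - (f : completion q) - (g : completion q)) +
            ((∑ j, s j * b j : Y.functionField) : completion q) := by
        rw [hgs, coe_add_completion, coe_add_completion]
        ring
      rw [h2]
      refine Valuation.map_add_le _ (le_trans h1 (hc1 q)) ?_
      rw [IsDedekindDomain.HeightOneSpectrum.adicCompletion.valued_coe]
      refine Valuation.map_sum_le _ fun j _ ↦ ?_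
      rw [map_mul]
      exact (mul_le_of_le_one_left' (hsq.2 (not_le.mp hq) j)).trans (hcb q j (not_le.mp hq))
  refine ⟨f + h, ⟨fun q ↦ (a q - ((f + h : Y.functionField) : completion q)) / (c q : completion q),
    Filter.Eventually.of_forall key⟩, key, Subtype.ext (funext fun q ↦ ?_)⟩
  change a q = ((f + h : Y.functionField) : completion q) + (c q : completion q) *
    ((a q - ((f + h : Y.functionField) : completion q)) / (c q : completion q))
  rw [mul_div_cancel₀ _ (hc0 q), add_sub_cancel]

theorem finiteIndex_sup [Finite k] : (Y.principalAdeles ⊔ Y.integralAdeles).FiniteIndex := by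
  obtain ⟨c, hc⟩ := Y.exists_eq_diagonal_add_mul
  refine AddSubgroup.finiteIndex_of_isCompact _
    (AddSubgroup.isOpen_mono le_sup_right Y.isOpen_integralAdeles)
    (Y.isCompact_integralAdeles.image (continuous_const_mul c)) fun a ↦ ?_
  obtain ⟨f, u, hu, rfl⟩ := hc a
  refine ⟨c * u, ⟨u, hu, rfl⟩, ?_⟩
  rw [add_sub_cancel_right]
  exact AddSubgroup.mem_sup_left ⟨f, rfl⟩

end SmoothProjCurve

/-- A compact open subgroup determines a normalization of the Haar measure. -/
theorem MeasureTheory.Measure.existsUnique_isAddHaarMeasure {G : Type*} [AddCommGroup G]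
    [TopologicalSpace G] [IsTopologicalAddGroup G] [SecondCountableTopology G]
    [MeasurableSpace G] [BorelSpace G] (K : TopologicalSpace.PositiveCompacts G) :
    ∃! ν : Measure G, ν.IsAddHaarMeasure ∧ ν K = 1 := by
  refine ⟨Measure.addHaarMeasure K, ⟨inferInstance, Measure.addHaarMeasure_self⟩, ?_⟩
  rintro ν ⟨h, hν⟩
  have : LocallyCompactSpace G := K.locallyCompactSpace_of_addGroup
  rw [Measure.addHaarMeasure_unique ν K, hν, one_smul]

/-! ### The product measure and the covolume of K -/

namespace SmoothProjCurve

variable {k : Type u} [Field k] (Y : SmoothProjCurve k)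

theorem existsUnique_isAddHaarMeasure [Finite k] (q : Y.ClosedPoint) :
    ∃! ν : Measure (completion q), ν.IsAddHaarMeasure ∧ ν (completionIntegers q) = 1 :=
  Measure.existsUnique_isAddHaarMeasure
    ⟨⟨completionIntegers q, isCompact_completionIntegers q⟩, by
      change (interior (completionIntegers q : Set (completion q))).Nonempty
      rw [(isOpen_completionIntegers q).interior_eq]
      exact ⟨0, zero_mem (completionIntegers q)⟩⟩

theorem exists_isProductMeasure [Finite k] (dx : ∀ q : Y.ClosedPoint, Measure (completion q))
    (hdx : ∀ q, (dx q).IsAddHaarMeasure ∧ dx q (completionIntegers q) = 1) :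
    ∃ μ : Measure Y.Adele, IsProductMeasure dx μ ∧ μ.IsAddLeftInvariant := by
  let : MeasurableSpace (Πʳ q : Y.ClosedPoint, [completion q, completionIntegers q]) :=
    inferInstanceAs (MeasurableSpace Y.Adele)
  have : BorelSpace (Πʳ q : Y.ClosedPoint, [completion q, completionIntegers q]) :=
    inferInstanceAs (BorelSpace Y.Adele)
  obtain ⟨μ, hμ, hμ1⟩ := RestrictedProduct.exists_isAddHaarMeasure
    (B := fun q : Y.ClosedPoint ↦ completionIntegers q)
    isOpen_completionIntegers isCompact_completionIntegers
  have hHaar (q) : (dx q).IsAddHaarMeasure := (hdx q).1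
  exact ⟨μ, fun S E hE hS ↦ RestrictedProduct.measure_box
    (B := fun q : Y.ClosedPoint ↦ completionIntegers q)
    isOpen_completionIntegers isCompact_completionIntegers μ hμ1 dx (fun q ↦ (hdx q).2) S E hE hS,
    hμ⟩

variable {Y} in
theorem IsProductMeasure.measure_integralAdeles
    {dx : ∀ q : Y.ClosedPoint, Measure (completion q)} {μ : Measure Y.Adele}
    (hμ : IsProductMeasure dx μ) : μ Y.integralAdeles = 1 :=
  hμ ∅ (fun q ↦ completionIntegers q) (fun q ↦ (isOpen_completionIntegers q).measurableSet)
    fun _ _ ↦ rfl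

-- Invariance is needed of one measure only: it makes the translates of the integral adeles have
-- measure one, which gives the finiteness under which boxes determine a measure.
variable {Y} in
theorem IsProductMeasure.eq [Finite k]
    {dx : ∀ q : Y.ClosedPoint, Measure (completion q)} {μ ν : Measure Y.Adele}
    (hμ : IsProductMeasure dx μ) (hν : IsProductMeasure dx ν) [μ.IsAddLeftInvariant] : μ = ν := by
  let : MeasurableSpace (Πʳ q : Y.ClosedPoint, [completion q, completionIntegers q]) :=
    inferInstanceAs (MeasurableSpace Y.Adele)
  have : BorelSpace (Πʳ q : Y.ClosedPoint, [completion q, completionIntegers q]) :=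
    inferInstanceAs (BorelSpace Y.Adele)
  refine RestrictedProduct.ext_of_boxes (B := fun q : Y.ClosedPoint ↦ completionIntegers q)
    isOpen_completionIntegers (fun x ↦ ?_) ?_
  · have h := measure_preimage_add μ (-x : Y.Adele) (Y.integralAdeles : Set Y.Adele)
    rw [hμ.measure_integralAdeles] at h
    refine ne_of_eq_of_ne (Eq.trans ?_ h) ENNReal.one_ne_top
    congr 1
    ext a
    refine forall_congr' fun q ↦ ?_
    change _ ↔ -x q + a q ∈ completionIntegers q
    rw [neg_add_eq_sub]
  · rintro _ ⟨t, E, hE, ht, rfl⟩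
    exact (hμ t E hE ht).trans (hν t E hE ht).symm

instance [Finite k] : Countable Y.principalAdeles :=
  Y.diagonal.toAddMonoidHom.rangeRestrict_surjective.countable

theorem addCovolume_principalAdeles [Finite k] {μ : Measure Y.Adele} [μ.IsAddLeftInvariant]
    (hμ : μ Y.integralAdeles = 1) : addCovolume Y.principalAdeles Y.Adele μ =
      (Y.principalAdeles ⊔ Y.integralAdeles).index /
        Nat.card (Y.principalAdeles ⊓ Y.integralAdeles : AddSubgroup Y.Adele) := by
  obtain ⟨q⟩ : Nonempty Y.ClosedPoint := inferInstance
  have := Y.finiteIndex_sup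
  -- `V` imposes vanishing modulo the maximal ideal at one point `q`. It meets `K` trivially: an
  -- everywhere regular function is in the field of global sections, so if nonzero it has a regular
  -- inverse and is a unit at `q`.
  let V : AddSubgroup Y.Adele :=
    { carrier := {a | a ∈ Y.integralAdeles ∧ Valued.v (a q) < 1}
      zero_mem' := ⟨zero_mem _, (map_zero Valued.v).trans_lt zero_lt_one⟩
      add_mem' := fun ha hb ↦ ⟨add_mem ha.1 hb.1, Valuation.map_add_lt _ ha.2 hb.2⟩
      neg_mem' := fun ha ↦ ⟨neg_mem ha.1, (Valuation.map_neg _ _).trans_lt ha.2⟩ }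
  have hev : Continuous fun a : Y.Adele ↦ a q :=
    RestrictedProduct.continuous_eval (A := fun q ↦ (completionIntegers q : Set (completion q))) q
  have hV : IsOpen (V : Set Y.Adele) :=
    Y.isOpen_integralAdeles.inter
      (((place q).isOpen_setOf_valued_lt one_ne_zero).preimage hev)
  refine addCovolume_eq_index_div_card μ _ _ V Y.isCompact_integralAdeles hμ (fun a ha ↦ ha.1) hV ?_
  rw [AddSubgroup.disjoint_def]
  rintro _ ⟨f, rfl⟩ ⟨hf, hfq⟩
  have : Nonempty (⊤ : Y.X.Opens) := ⟨⟨genericPoint Y.X, trivial⟩⟩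
  obtain ⟨s, rfl⟩ := exists_germToFunctionField_eq (U := ⊤) f fun q _ ↦ hf q
  by_cases hs : s = 0
  · subst hs
    exact (congrArg Y.diagonal (map_zero (Y.X.germToFunctionField ⊤).hom)).trans (map_zero _)
  exfalso
  obtain ⟨s', hs'⟩ := (isField_of_universallyClosed k Y.hom).mul_inv_cancel hs
  have h1 : Valued.v ((Y.X.germToFunctionField ⊤ s : Y.functionField) : completion q) < 1 := hfq
  have h2 := coe_germToFunctionField_mem_completionIntegers s' q trivial
  rw [IsDedekindDomain.HeightOneSpectrum.mem_adicCompletionIntegers] at h2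
  have h3 := mul_lt_one_of_lt_of_le h1 h2
  rw [← map_mul, ← IsDedekindDomain.HeightOneSpectrum.adicCompletion.coe_mul,
    ← map_mul, hs', map_one, IsDedekindDomain.HeightOneSpectrum.adicCompletion.coe_one,
    map_one] at h3
  exact lt_irrefl _ h3

theorem natCard_H1_eq_pow_genus [Finite k] : Nat.card Y.H1 = Nat.card k ^ Y.genus := by
  -- Finiteness must come first: `Nat.card` and `finrank` both take the default value zero in the
  -- infinite case.
  have hfin : Nat.card Y.H1 ≠ 0 := by
    rw [natCard_H1]
    exact Y.finiteIndex_sup.index_ne_zero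
  have : Finite Y.H1 := Nat.finite_of_card_ne_zero hfin
  have : Module.Finite k Y.H1 := .of_finite
  exact Module.natCard_eq_pow_finrank

end SmoothProjCurve

theorem proposition2p2 {k : Type u} [Field k] [Finite k] (Y : SmoothProjCurve k) :
    CompactSpace (Y.Adele ⧸ Y.principalAdeles) ∧
    (∀ q : Y.ClosedPoint, ∃! ν : Measure (SmoothProjCurve.completion q),
      ν.IsAddHaarMeasure ∧ ν (SmoothProjCurve.completionIntegers q) = 1) ∧
    ∀ dx : ∀ q : Y.ClosedPoint, Measure (SmoothProjCurve.completion q),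
      (∀ q, (dx q).IsAddHaarMeasure ∧ dx q (SmoothProjCurve.completionIntegers q) = 1) →
      ∃ μ : Measure Y.Adele, SmoothProjCurve.IsProductMeasure dx μ ∧
        (∀ μ', SmoothProjCurve.IsProductMeasure dx μ' → μ' = μ) ∧
        addCovolume Y.principalAdeles Y.Adele μ =
          (Nat.card k : ENNReal) ^ ((Y.genus : ℤ) - 1) := by
  refine ⟨compactSpace_quotient_of_finiteIndex _ _ Y.isCompact_integralAdeles Y.finiteIndex_sup,
    Y.existsUnique_isAddHaarMeasure, fun dx hdx ↦ ?_⟩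
  obtain ⟨μ, hμ, hinv⟩ := Y.exists_isProductMeasure dx hdx
  refine ⟨μ, hμ, fun ν hν ↦ (hμ.eq hν).symm, ?_⟩
  -- The exponent is an integer, equal to `-1` in genus zero. Splitting the power in `ENNReal`
  -- requires `Nat.card k` to be nonzero and finite.
  rw [Y.addCovolume_principalAdeles hμ.measure_integralAdeles, ← Y.natCard_H1,
    Y.natCard_H1_eq_pow_genus, Y.natCard_principalAdeles_inf_integralAdeles, sub_eq_add_neg,
    ENNReal.zpow_add (by exact_mod_cast Nat.card_pos.ne') (ENNReal.natCast_ne_top _),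
    zpow_natCast, zpow_neg_one, Nat.cast_pow, div_eq_mul_inv]
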